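/- All trees may be infinite, and the empty tree counts as a tree. A tree $T$ is \emph{scattered} if no subdivision of the binary tree $\mathrm{T}_2$ (whose vertices are the finite $0$-$1$-sequences, each sequence $s$ being adjacent to $s0$ and $s1$) is embeddable into $T$ as a subtree. A \emph{ray} of $T$ is a one-way infinite path of $T$; two rays are equivalent if they coincide outside some finite set of vertices, and the equivalence classes are the \emph{ends} of $T$. The set $\Omega(T)$ of ends carries the topology generated by the sets $\Omega_{r,s}$ ($r,s\in V(T)$), where $\Omega_{r,s}$ is the set of ends containing a ray that starts at $r$ and passes through $s$. (For any fixed vertex $r$, the sets $\Omega_{r,s}$, $s \in V(T)$, already form a basis of it.) A topological space is \emph{topologically scattered} if every nonempty subset $S$ has a point that is isolated in $S$. Consider the following operations on rooted trees, where the empty tree $\Box$ is allowed and rooted trees are considered up to isomorphism. The \emph{successor} $1+T$ is obtained from $T$ by adding a new vertex joined to the root of $T$ (if $T \neq \Box$) and taking it as the new root. The \emph{sup} $\bigvee_{i\in I}T_i$ is obtained from disjoint copies of the $T_i$ by identifying all their roots. The \emph{sum} $\bigoplus_{n\in\mathbb{N}}T_n$ of a sequence in which every term after an empty one is empty is obtained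 from disjoint copies of the $T_n$ by joining, for every $n$ such that $T_{n+1}$ is nonempty, the root of $T_n$ to the root of $T_{n+1}$, and taking the root of $T_0$ as the root. For a class $\mathcal{X}$ of rooted trees let $\mathcal{X}^{\mathrm{suc},\sup}$ be the smallest class of rooted trees that contains $\mathcal{X}$ and is closed under successors and sups, and let $\bigoplus_{n\in\mathbb{N}}\mathcal{X}$ be the class of all sums $\bigoplus_{n\in\mathbb{N}}T_n$ with all $T_n\in\mathcal{X}$. Define by transfinite recursion $\mathcal{D}_r^{(0)}=\{\Box\}^{\mathrm{suc},\sup}$, $\mathcal{D}_r^{(\beta+1)}=\bigl(\bigoplus_{n\in\mathbb{N}}\mathcal{D}_r^{(\beta)}\bigr)^{\mathrm{suc},\sup}$, and $\mathcal{D}_r^{(\alpha)}=\bigl(\bigcup_{\beta<\alpha}\mathcal{D}_r^{(\beta)}\bigr)^{\mathrm{suc},\sup}$ for every nonzero limit ordinal $\alpha$. Let $\mathcal{D}$ be the class of trees obtained by forgetting the roots of the members of $\bigcup_{\alpha}\mathcal{D}_r^{(\alpha)}$. Theorem. For every tree $T$ the following are equivalent: (i) $T$ is scattered; (ii) $\Omega(T)$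 is topologically scattered; (iii) $T\in\mathcal{D}$. -/

import Mathlib

universe u v w

namespace ScatteredTrees

/-! ## Subdivisions and scattered trees -/

/-- `Subdivision G H` exhibits `H` as a subdivision of `G`: every edge `uv` of `G` is replaced by
a path of `H` between the branch vertices of `u` and `v`, distinct edges are replaced by internally
disjoint paths whose inner vertices are not branch vertices, and `H` has no other vertices or
edges. -/
structure Subdivision {V : Type v} {W : Type w} (G : SimpleGraph V) (H : SimpleGraph W) where
  branch : V → W
  branch_injective : Function.Injective branch
  path : ∀ u v : V, G.Adj u v → H.Walk (branch u) (branch v)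
  path_isPath : ∀ u v (h : G.Adj u v), (path u v h).IsPath
  path_symm : ∀ u v (h : G.Adj u v), path v u h.symm = (path u v h).reverse
  branch_mem : ∀ u v (h : G.Adj u v) (x : V),
    branch x ∈ (path u v h).support → x = u ∨ x = v
  disjoint : ∀ u v (h : G.Adj u v) u' v' (h' : G.Adj u' v') (x : W),
    s(u, v) ≠ s(u', v') → x ∈ (path u v h).support → x ∈ (path u' v' h').support →
      x = branch u ∨ x = branch v
  vertex_cover : ∀ x : W,
    (∃ v, x = branch v) ∨ ∃ u v, ∃ h : G.Adj u v, x ∈ (path u v h).support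
  edge_cover : ∀ x y : W, H.Adj x y → ∃ u v, ∃ h : G.Adj u v, s(x, y) ∈ (path u v h).edges

/-- The binary tree: the vertices are the finite `0`-`1`-sequences, and the edges join each
sequence `s` to the sequences obtained by adding one entry on the right of `s`. -/
def binaryTree : SimpleGraph (List Bool) :=
  SimpleGraph.fromRel (fun s t => ∃ b : Bool, t = s ++ [b])

/-- No subdivision of the binary tree is embeddable into `T`. (The universe of `W` is no
restriction: a graph that embeds into `T` is isomorphic to a graph on a subset of `V`.) -/
def IsScattered {V : Type u} (T : SimpleGraph V) : Prop :=
  ∀ (W : Type u) (H : SimpleGraph W), Nonempty (Subdivision binaryTree H) → IsEmpty (H ↪g T)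

/-! ## The space of ends -/

/-- A ray, that is, a one-way infinite path, enumerated from its origin. -/
structure Ray {V : Type u} (T : SimpleGraph V) where
  vertex : ℕ → V
  injective : Function.Injective vertex
  adj : ∀ n, T.Adj (vertex n) (vertex (n + 1))

/-- The set of vertices of a ray. -/
def Ray.verts {V : Type u} {T : SimpleGraph V} (C : Ray T) : Set V := Set.range C.vertex

/-- Two rays are equivalent if they coincide outside some finite set of vertices. -/
def rayEquivalence {V : Type u} (T : SimpleGraph V) : Setoid (Ray T) where
  r C C' := ∃ F : Set V, F.Finite ∧ C.verts \ F = C'.verts \ F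
  iseqv :=
    { refl := fun _ => ⟨∅, Set.finite_empty, rfl⟩
      symm := fun ⟨F, hF, h⟩ => ⟨F, hF, h.symm⟩
      trans := fun ⟨F, hF, h⟩ ⟨F', hF', h'⟩ =>
        ⟨F ∪ F', hF.union hF', by
          rw [← Set.sdiff_sdiff, h, Set.sdiff_sdiff, Set.union_comm, ← Set.sdiff_sdiff, h',
            Set.sdiff_sdiff]⟩ }

/-- The ends of `T` are the equivalence classes of rays. -/
def Ends {V : Type u} (T : SimpleGraph V) : Type u := Quotient (rayEquivalence T)

/-- The end that contains a given ray. -/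
def Ray.toEnd {V : Type u} {T : SimpleGraph V} (C : Ray T) : Ends T :=
  Quotient.mk (rayEquivalence T) C

/-- The set of ends that contain a ray with origin `r` that passes through `s`. -/
def endsThrough {V : Type u} (T : SimpleGraph V) (r s : V) : Set (Ends T) :=
  {e | ∃ C : Ray T, C.toEnd = e ∧ C.vertex 0 = r ∧ s ∈ C.verts}

/-- The topology on the ends. When `T` is a tree, the sets `endsThrough T r s` with `r` fixed form
a basis of a topology that does not depend on `r`; this is the topology here. -/
instance endsTopology {V : Type u} (T : SimpleGraph V) : TopologicalSpace (Ends T) :=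
  TopologicalSpace.generateFrom {U | ∃ r s : V, U = endsThrough T r s}

/-- Every nonempty subset has a point that is isolated in it. -/
def TopologicallyScattered (X : Type u) [TopologicalSpace X] : Prop :=
  ∀ S : Set X, S.Nonempty → ∃ x ∈ S, ∃ U : Set X, IsOpen U ∧ U ∩ S = {x}

/-! ## Rooted trees and operations on them -/

/-- A rooted tree, possibly the empty tree; only the empty tree has no root. -/
structure RootedTree : Type (u + 1) where
  V : Type u
  graph : SimpleGraph V
  preconnected : graph.Preconnected
  isAcyclic : graph.IsAcyclic
  root : Option V
  isEmpty_of_root_eq_none : root = none → IsEmpty V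

/-- `T = 1 + T'` (up to isomorphism): `T` is obtained from `T'` by adding a new vertex `a`, joined
to the root of `T'` if there is one and to nothing else, and by choosing `a` as the root. -/
def IsSuc (T T' : RootedTree.{u}) : Prop :=
  ∃ (a : T.V) (e : T'.graph ↪g T.graph),
    T.root = some a ∧
    (∀ y, e y ≠ a) ∧
    (∀ x, x = a ∨ ∃ y, e y = x) ∧
    (∀ y, T.graph.Adj a (e y) ↔ T'.root = some y)

/-- `T = ⋁ i, F i` (up to isomorphism): `T` is obtained from disjoint copies of the `F i` by
identifying all their roots to a single one, the root of `T`. -/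
def IsSup (T : RootedTree.{u}) {I : Type u} (F : I → RootedTree.{u}) : Prop :=
  ∃ e : ∀ i, (F i).graph ↪g T.graph,
    (∀ i y, (F i).root = some y → T.root = some (e i y)) ∧
    (∀ x, ∃ i y, e i y = x) ∧
    (∀ i j y z, i ≠ j → e i y = e j z → T.root = some (e i y)) ∧
    (∀ x x', T.graph.Adj x x' → ∃ i y y', e i y = x ∧ e i y' = x')

/-- `T = ⨁ n, F n` (up to isomorphism): `T` is obtained from disjoint copies of the `F n` by joining
the roots of `F n` and `F (n + 1)` for all `n`, and its root is that of `F 0`. The `F n` may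
be empty from some index on, in which case this is a sum over a finite path. -/
def IsPathSum (T : RootedTree.{u}) (F : ℕ → RootedTree.{u}) : Prop :=
  (∀ n, IsEmpty (F n).V → IsEmpty (F (n + 1)).V) ∧
  ∃ e : ∀ n, (F n).graph ↪g T.graph,
    T.root = (F 0).root.map (e 0) ∧
    (∀ x, ∃ n y, e n y = x) ∧
    (∀ m n y z, m ≠ n → e m y ≠ e n z) ∧
    (∀ m n y z, m ≠ n → (T.graph.Adj (e m y) (e n z) ↔
      (n = m + 1 ∨ m = n + 1) ∧ (F m).root = some y ∧ (F n).root = some z))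

/-- The smallest class of rooted trees that contains `X` and is closed under successors and
suprema. -/
inductive SucSupClosure (X : Set RootedTree.{u}) : RootedTree.{u} → Prop
  | base (T : RootedTree.{u}) : T ∈ X → SucSupClosure X T
  | suc (T T' : RootedTree.{u}) : IsSuc T T' → SucSupClosure X T' → SucSupClosure X T
  | sup (T : RootedTree.{u}) (I : Type u) (F : I → RootedTree.{u}) :
      IsSup T F → (∀ i, SucSupClosure X (F i)) → SucSupClosure X T

/-- The class of all sums over `ℕ` of sequences of members of `X`. -/
def pathSums (X : Set RootedTree.{u}) : Set RootedTree.{u} :=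
  {T | ∃ F : ℕ → RootedTree.{u}, (∀ n, F n ∈ X) ∧ IsPathSum T F}

/-- The classes of rooted trees obtained by transfinite recursion: the closure of the empty tree at
`0`, the closure of the sums over `ℕ` of members of the previous class at successors, and the
closure of the union of the previous classes at limits. -/
noncomputable def rootedClass (α : Ordinal.{u}) : Set RootedTree.{u} :=
  Ordinal.limitRecOn α
    {T | SucSupClosure {T' | IsEmpty T'.V} T}
    (fun _ X => {T | SucSupClosure (pathSums X) T})
    (fun α _ X => {T | SucSupClosure {T' | ∃ β, ∃ h : β < α, T' ∈ X β h} T})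

theorem rootedClass_zero :
    rootedClass.{u} 0 = {T | SucSupClosure {T' | IsEmpty T'.V} T} := by
  simp only [rootedClass, Ordinal.limitRecOn_zero]

theorem rootedClass_add_one (β : Ordinal.{u}) :
    rootedClass (β + 1) = {T | SucSupClosure (pathSums (rootedClass β)) T} := by
  simp only [rootedClass, Ordinal.limitRecOn_add_one]

theorem rootedClass_limit (α : Ordinal.{u}) (h : Order.IsSuccLimit α) :
    rootedClass α = {T | SucSupClosure {T' | ∃ β < α, T' ∈ rootedClass β} T} := by
  simp only [rootedClass, Ordinal.limitRecOn_limit _ _ _ _ h, exists_prop]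

/-- `T` is, up to isomorphism, obtained from a member of one of the classes `rootedClass α` by
forgetting the root. -/
def InClassD {V : Type u} (T : SimpleGraph V) : Prop :=
  ∃ (α : Ordinal.{u}) (R : RootedTree.{u}), R ∈ rootedClass α ∧ Nonempty (R.graph ≃g T)

end ScatteredTrees

namespace ScatteredTrees

open SimpleGraph Filter

/-! Fix a root `r` and order the tree by `x ≤ y` if `x` lies on the path from `r` to `y`. All three
conditions say that there is no branching set: a nonempty set of vertices each of whose members lies
below two incomparable members.

A branching set yields, by repeated choice of two incomparable successors, an order embedding of
the finite `0`-`1`-sequences; after moving each branch vertex to the meet of the two above it, the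
paths between them form a subdivision of the binary tree. Conversely, the branch vertices of a
subdivision that lie above a suitable one form a branching set.

If `B` branches, then the set of the ends all of whose initial vertices lie below members of `B` has
no isolated point. If a set of ends has no isolated point, then the vertices through which its ends
pass form a branching set.

The operations that build the class `𝒟` preserve the absence of branching sets, as a branching set
is not a chain and therefore branches within one of the trees put together. Conversely, suppose that
there is no branching set, and let `α` be so large that every tree above a vertex that belongs to
some class of the hierarchy belongs to the `α`-th. The vertices that fail this do not branch, so
above one of them they form a path; but the tree above that vertex is then a sum along the path of
trees in the `α`-th class. -/

/-! ## Betweenness and the tree order -/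

/-- Every walk from `r` to `y` passes through `x`. In a tree this says that `x` lies on the path
from `r` to `y`, and for a fixed root `r` the relation `Between T r` is the tree order. -/
def Between {V : Type*} (T : SimpleGraph V) (r x y : V) : Prop :=
  ∀ p : T.Walk r y, x ∈ p.support

/-- In the tree `T` with root `r`, the vertex `c` is a child of `v`. -/
def IsChild {V : Type*} (T : SimpleGraph V) (r v c : V) : Prop :=
  T.Adj v c ∧ Between T r v c

section Between

variable {V : Type*} {T : SimpleGraph V} {r x y z : V}

theorem Between.refl (x : V) : Between T r x x := fun p => p.end_mem_support

theorem root_between (x : V) : Between T r r x := fun p => p.start_mem_support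

theorem Between.trans (hxy : Between T r x y) (hyz : Between T r y z) : Between T r x z := by
  classical
  exact fun p => p.support_takeUntil_subset_support (hyz p) (hxy _)

instance : Std.Refl (Between T r) := ⟨Between.refl⟩

instance : IsTrans V (Between T r) := ⟨fun _ _ _ => Between.trans⟩

theorem Between.symm (h : Between T x y z) : Between T z y x := fun p => by
  simpa using h p.reverse

theorem Between.between_or_between (h : Between T x y z) (w : V) :
    Between T w y x ∨ Between T w y z := by
  simp only [Between, ← not_exists_not] at *
  by_contra!
  obtain ⟨⟨p, hp⟩, q, hq⟩ := this
  exact h ⟨p.reverse.append q, by simp [Walk.mem_support_append_iff, hp, hq]⟩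

theorem Between.of_adj (h : Between T r x z) (hne : x ≠ z) (hyz : T.Adj y z) :
    Between T r x y := by
  intro p
  simpa [Walk.support_concat, hne] using h (p.concat hyz)

theorem Between.dist_lt (hc : T.Preconnected) (h : Between T r x y) (hne : x ≠ y) :
    T.dist r x < T.dist r y := by
  classical
  obtain ⟨p, hp⟩ := (hc r y).exists_walk_length_eq_dist
  rw [← hp]
  exact (dist_le _).trans_lt (Walk.length_takeUntil_lt_length (h p) hne)

theorem Between.antisymm (hc : T.Preconnected) (hxy : Between T r x y) (hyx : Between T r y x) :
    x = y := by
  by_contra hne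
  exact (hxy.dist_lt hc hne).asymm (hyx.dist_lt hc (Ne.symm hne))

theorem Between.total (hc : T.Preconnected) (hx : Between T r x z) (hy : Between T r y z) :
    Between T r x y ∨ Between T r y x := by
  rcases hx.between_or_between y with hx' | hx'
  · exact Or.inl hx'.symm
  rcases hy.between_or_between x with hy' | hy'
  · exact Or.inr hy'.symm
  · obtain rfl := hx'.symm.antisymm hc hy'.symm
    exact Or.inl (.refl x)

theorem Between.between_iff (hc : T.Preconnected) (h : Between T r x z) :
    Between T x y z ↔ Between T r x y ∧ Between T r y z := by
  constructor
  · intro hy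
    refine ⟨?_, (hy.between_or_between r).elim (fun hyx => hyx.trans h) id⟩
    rcases h.between_or_between y with hx | hx
    · exact hx.symm
    · obtain rfl := hx.symm.antisymm hc hy.symm
      exact .refl x
  · rintro ⟨hxy, hyz⟩
    rcases hyz.between_or_between x with hy | hy
    · obtain rfl := hxy.antisymm hc hy.symm
      exact root_between z
    · exact hy

theorem exists_meet (hc : T.Preconnected) (r x y : V) :
    ∃ m, Between T r m x ∧ Between T r m y ∧
      ∀ z, Between T r z x → Between T r z y → Between T r z m := by
  obtain ⟨m, ⟨hx, hy⟩, hm⟩ := exists_minimalFor_of_wellFoundedLT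
    (fun z => Between T r z x ∧ Between T r z y) (T.dist x) ⟨r, root_between x, root_between y⟩
  refine ⟨m, hx, hy, fun z hzx hzy => (hzx.total hc hx).elim id fun hmz => ?_⟩
  have hz : Between T x z m := ((hx.between_iff hc).2 ⟨hmz, hzx⟩).symm
  by_contra hne
  have hlt := hz.dist_lt hc fun h => hne (h ▸ .refl z)
  exact hlt.not_ge (hm ⟨hzx, hzy⟩ hlt.le)

theorem IsChild.parent_unique (hc : T.Preconnected) (hx : IsChild T r x z)
    (hy : IsChild T r y z) : x = y :=
  (hx.2.of_adj hx.1.ne hy.1).antisymm hc (hy.2.of_adj hy.1.ne hx.1)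

theorem IsChild.eq_of_between (hc : T.Preconnected) {c d : V} (h : IsChild T r x c)
    (hd : IsChild T r x d) (hcz : Between T r c z) (hdz : Between T r d z) : c = d := by
  by_contra hne
  rcases hcz.total hc hdz with hcd | hdc
  · exact h.1.ne (h.2.antisymm hc (hcd.of_adj hne hd.1))
  · exact hd.1.ne (hd.2.antisymm hc (hdc.of_adj (Ne.symm hne) h.1))

theorem mem_support_iff_between (ha : T.IsAcyclic) {p : T.Walk x z} (hp : p.IsPath) :
    y ∈ p.support ↔ Between T x y z := by
  classical
  refine ⟨fun hy q => q.support_bypass_subset_support ?_, fun h => h p⟩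
  have hpq : q.bypass = p :=
    congrArg Subtype.val ((ha.subsingleton_path x z).elim ⟨_, q.bypass_isPath⟩ ⟨p, hp⟩)
  rwa [hpq]

theorem between_or_between_of_adj (hc : T.Preconnected) (ha : T.IsAcyclic) (h : T.Adj x y) :
    Between T r x y ∨ Between T r y x := by
  obtain ⟨p, hp⟩ := hc.exists_isPath r x
  by_cases hy : y ∈ p.support
  · exact Or.inr ((mem_support_iff_between ha hp).1 hy)
  · refine Or.inl ((mem_support_iff_between ha (hp.concat hy h)).1 ?_)
    simp [Walk.support_concat]

theorem isChild_or_isChild_of_adj (hc : T.Preconnected) (ha : T.IsAcyclic) (h : T.Adj x y) :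
    IsChild T r x y ∨ IsChild T r y x :=
  (between_or_between_of_adj hc ha h).imp (⟨h, ·⟩) (⟨h.symm, ·⟩)

theorem exists_isChild_between (hc : T.Preconnected) (ha : T.IsAcyclic) (h : Between T r x z)
    (hne : x ≠ z) : ∃ c, IsChild T r x c ∧ Between T r c z := by
  obtain ⟨p, hp⟩ := hc.exists_isPath x z
  have hc' := (h.between_iff hc).1 ((mem_support_iff_between ha hp).1 (p.getVert_mem_support 1))
  exact ⟨p.snd, ⟨p.adj_snd (Walk.not_nil_of_ne hne), hc'.1⟩, hc'.2⟩

theorem between_embedding_iff {W : Type*} {F : SimpleGraph W} (hF : F.Preconnected)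
    (ha : T.IsAcyclic) (e : F ↪g T) {a b c : W} :
    Between T (e a) (e b) (e c) ↔ Between F a b c := by
  obtain ⟨p, hp⟩ := hF.exists_isPath a c
  rw [← mem_support_iff_between (ha.embedding e) hp]
  refine (mem_support_iff_between ha (hp.map (f := e.toHom) e.injective)).symm.trans ?_
  simp

theorem mem_edges_of_adj (ha : T.IsAcyclic) {p : T.Walk x z} {a b : V} (h : T.Adj a b)
    (hap : a ∈ p.support) (hbp : b ∈ p.support) : s(a, b) ∈ p.edges := by
  classical
  have hab := isBridge_iff_forall_walk_mem_edges.1 (isAcyclic_iff_forall_adj_isBridge.1 ha h)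
    ((p.takeUntil a hap).reverse.append (p.takeUntil b hbp))
  rw [Walk.edges_append, Walk.edges_reverse, List.mem_append, List.mem_reverse] at hab
  exact hab.elim (p.edges_takeUntil_subset_edges hap ·) (p.edges_takeUntil_subset_edges hbp ·)

end Between

/-- In the tree `T` with root `r`, the set `A` has the least element `v` and contains every vertex
between `v` and a member of `A`; thus `A` spans a tree, to be regarded as rooted at `v`. -/
structure RootedAt {V : Type*} (T : SimpleGraph V) (r v : V) (A : Set V) : Prop where
  mem : v ∈ A
  between : ∀ x ∈ A, Between T r v x
  mem_of_between : ∀ x ∈ A, ∀ y, Between T r v y → Between T r y x → y ∈ A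

theorem RootedAt.preconnected {V : Type*} {T : SimpleGraph V} {r v : V} {A : Set V}
    (h : RootedAt T r v A) (hc : T.Preconnected) (ha : T.IsAcyclic) :
    (T.induce A).Preconnected := by
  have hv : ∀ x : A, (T.induce A).Reachable ⟨v, h.mem⟩ x := by
    rintro ⟨x, hx⟩
    obtain ⟨p, hp⟩ := hc.exists_isPath v x
    refine ⟨p.induce A fun y hy => ?_⟩
    have hy' := ((h.between x hx).between_iff hc).1 ((mem_support_iff_between ha hp).1 hy)
    exact h.mem_of_between x hx y hy'.1 hy'.2
  exact fun x y => (hv x).symm.trans (hv y)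

/-! ## Branching sets and subdivisions of the binary tree -/

/-- In the tree with root `r`, some nonempty set of vertices is such that each of its members lies
below two incomparable ones. -/
def Branching {V : Type*} (T : SimpleGraph V) (r : V) : Prop :=
  ∃ B : Set V, B.Nonempty ∧ ∀ b ∈ B, ∃ c ∈ B, ∃ d ∈ B,
    Between T r b c ∧ Between T r b d ∧ ¬ Between T r c d ∧ ¬ Between T r d c

theorem exists_isChain_of_not_branching {V : Type*} {T : SimpleGraph V} {r : V}
    (h : ¬ Branching T r) {B : Set V} (hB : B.Nonempty) :
    ∃ b ∈ B, IsChain (Between T r) {c ∈ B | Between T r b c} := by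
  by_contra! hn
  refine h ⟨B, hB, fun b hb => ?_⟩
  have hb := hn b hb
  simp only [IsChain, Set.Pairwise, not_forall, not_or] at hb
  obtain ⟨c, ⟨hc, hbc⟩, d, ⟨hd, hbd⟩, -, hcd, hdc⟩ := hb
  exact ⟨c, hc, d, hd, hbc, hbd, hcd, hdc⟩

theorem binaryTree_adj_append (s : List Bool) (b : Bool) : binaryTree.Adj s (s ++ [b]) := by
  simp [binaryTree]

theorem exists_append_of_binaryTree_adj {s t : List Bool} (h : binaryTree.Adj s t) :
    (∃ b, t = s ++ [b]) ∨ ∃ b, s = t ++ [b] := by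
  simpa [binaryTree] using (fromRel_adj _ _ _).1 h |>.2

section Subdivision

variable {V U W : Type*} {T : SimpleGraph V} {r : V} {G : SimpleGraph U} {H : SimpleGraph W}

theorem Subdivision.isPath_append (S : Subdivision G H) {s t t' : U} (h : G.Adj s t)
    (h' : G.Adj s t') (hne : t ≠ t') :
    ((S.path s t h).reverse.append (S.path s t' h')).IsPath := by
  have hnodup := (S.path_isPath s t' h').support_nodup
  rw [← Walk.cons_tail_support, List.nodup_cons] at hnodup
  rw [Walk.isPath_def, Walk.support_append, List.nodup_append']
  refine ⟨(S.path_isPath s t h).reverse.support_nodup, hnodup.2, fun x hx hx' => ?_⟩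
  rw [Walk.support_reverse, List.mem_reverse] at hx
  have hs : s(s, t) ≠ s(s, t') := fun e => hne (Sym2.congr_right.1 e)
  rcases S.disjoint _ _ h _ _ h' x hs hx (List.mem_of_mem_tail hx') with rfl | rfl
  · exact hnodup.1 hx'
  · rcases S.branch_mem _ _ h' t (List.mem_of_mem_tail hx') with rfl | rfl
    exacts [h.ne rfl, hne rfl]

theorem Subdivision.between (S : Subdivision G H) (ha : T.IsAcyclic) (f : H ↪g T) {s t t' : U}
    (h : G.Adj s t) (h' : G.Adj s t') (hne : t ≠ t') :
    Between T (f (S.branch t)) (f (S.branch s)) (f (S.branch t')) := by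
  refine (mem_support_iff_between ha
    ((S.isPath_append h h' hne).map (f := f.toHom) f.injective)).1 ?_
  simp [Walk.mem_support_append_iff]

theorem exists_forall_between_append (hc : T.Preconnected) (g : List Bool → V)
    (hinj : Function.Injective g)
    (hg : ∀ s t t', binaryTree.Adj s t → binaryTree.Adj s t' → t ≠ t' →
      Between T (g t) (g s) (g t')) :
    ∃ b, ∀ s c, Between T r (g (b :: s)) (g (b :: s ++ [c])) := by
  have hstep : ∀ s d c, Between T r (g s) (g (s ++ [d])) →
      Between T r (g (s ++ [d])) (g (s ++ [d] ++ [c])) := by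
    intro s d c h
    refine ((hg (s ++ [d]) s _ (binaryTree_adj_append s d).symm (binaryTree_adj_append _ c)
      (by simp)).between_or_between r).resolve_left fun h' => ?_
    exact (binaryTree_adj_append s d).ne (hinj (h.antisymm hc h'))
  obtain ⟨b, hb⟩ : ∃ b, Between T r (g []) (g [b]) := by
    rcases (hg [] [true] [false] (binaryTree_adj_append [] true) (binaryTree_adj_append [] false)
      (by simp)).between_or_between r with h | h
    exacts [⟨_, h⟩, ⟨_, h⟩]
  refine ⟨b, fun s => ?_⟩
  induction s using List.reverseRecOn with
  | nil => exact fun c => hstep [] b c hb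
  | append_singleton s d ih => exact fun c => hstep (b :: s) d c (ih d)

theorem branching_of_between (hc : T.Preconnected) (g : List Bool → V)
    (hinj : Function.Injective g)
    (hg : ∀ s t t', binaryTree.Adj s t → binaryTree.Adj s t' → t ≠ t' →
      Between T (g t) (g s) (g t')) :
    Branching T r := by
  obtain ⟨b, hb⟩ := exists_forall_between_append (r := r) hc g hinj hg
  have hnot : ∀ s c d, c ≠ d →
      ¬ Between T r (g (b :: s ++ [c])) (g (b :: s ++ [d])) := by
    intro s c d hcd h
    have hs := hg _ _ _ (binaryTree_adj_append (b :: s) c) (binaryTree_adj_append (b :: s) d)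
      (by simpa using hcd)
    exact (binaryTree_adj_append (b :: s) c).ne
      (hinj ((hb s c).antisymm hc ((h.between_iff hc).1 hs).1))
  refine ⟨Set.range fun s => g (b :: s), Set.range_nonempty _, ?_⟩
  rintro _ ⟨s, rfl⟩
  exact ⟨_, ⟨s ++ [true], rfl⟩, _, ⟨s ++ [false], rfl⟩, hb s _, hb s _, hnot s _ _ (by simp),
    hnot s _ _ (by simp)⟩

/-- A tree is a subdivision of `G` as soon as the vertices of `G` can be placed in it in such a way
that the paths of the tree which join neighbours are internally disjoint and cover the tree. -/
noncomputable def Subdivision.ofBetween (hc : H.Preconnected) (ha : H.IsAcyclic) (f : U → W)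
    (hf : Function.Injective f)
    (eq_or_eq : ∀ u v x, G.Adj u v → Between H (f u) (f x) (f v) → x = u ∨ x = v)
    (disjoint : ∀ u v u' v' x, G.Adj u v → G.Adj u' v' → s(u, v) ≠ s(u', v') →
      Between H (f u) x (f v) → Between H (f u') x (f v') → x = f u ∨ x = f v)
    (vertex_cover : ∀ x, ∃ u v, G.Adj u v ∧ Between H (f u) x (f v))
    (edge_cover : ∀ x y, H.Adj x y →
      ∃ u v, G.Adj u v ∧ Between H (f u) x (f v) ∧ Between H (f u) y (f v)) :
    Subdivision G H where
  branch := f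
  branch_injective := hf
  path u v _ := (hc.exists_isPath (f u) (f v)).choose
  path_isPath u v _ := (hc.exists_isPath (f u) (f v)).choose_spec
  path_symm u v _ := congrArg Subtype.val <| (ha.subsingleton_path _ _).elim
    ⟨_, (hc.exists_isPath _ _).choose_spec⟩ ⟨_, (hc.exists_isPath _ _).choose_spec.reverse⟩
  branch_mem u v h x hx :=
    eq_or_eq u v x h ((mem_support_iff_between ha (hc.exists_isPath _ _).choose_spec).1 hx)
  disjoint u v h u' v' h' x hne hx hx' := disjoint u v u' v' x h h' hne
    ((mem_support_iff_between ha (hc.exists_isPath _ _).choose_spec).1 hx)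
    ((mem_support_iff_between ha (hc.exists_isPath _ _).choose_spec).1 hx')
  vertex_cover x := by
    obtain ⟨u, v, h, hx⟩ := vertex_cover x
    exact Or.inr ⟨u, v, h, hx _⟩
  edge_cover x y hxy := by
    obtain ⟨u, v, h, hx, hy⟩ := edge_cover x y hxy
    exact ⟨u, v, h, mem_edges_of_adj ha hxy (hx _) (hy _)⟩

end Subdivision

/-- A copy of the order of the binary tree in the order of the tree with root `r`. The last field
says that the copy of `s` is the meet of those of `s0` and `s1`; it is what makes the paths that
join the copies of neighbours internally disjoint. -/
structure BinaryMap {V : Type*} (T : SimpleGraph V) (r : V) where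
  vertex : List Bool → V
  between : ∀ s b, Between T r (vertex s) (vertex (s ++ [b]))
  vertex_ne : ∀ s b, vertex s ≠ vertex (s ++ [b])
  meet : ∀ s x, (∀ b, Between T r x (vertex (s ++ [b]))) → Between T r x (vertex s)

section BinaryMap

variable {V : Type*} {T : SimpleGraph V} {r : V}

theorem Branching.exists_binaryMap (hc : T.Preconnected) (h : Branching T r) :
    Nonempty (BinaryMap T r) := by
  obtain ⟨B, ⟨b₀, hb₀⟩, hB⟩ := h
  have hnext : ∀ b : B, ∃ c : Bool → B, (∀ i, Between T r (b : V) (c i)) ∧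
      ∀ i j, i ≠ j → ¬ Between T r (c i : V) (c j) := by
    rintro ⟨b, hb⟩
    obtain ⟨c, hc, d, hd, hbc, hbd, hcd, hdc⟩ := hB b hb
    exact ⟨fun i => if i then ⟨c, hc⟩ else ⟨d, hd⟩, by simp [hbc, hbd], by simp [hcd, hdc]⟩
  choose c hbc hcc using hnext
  choose m hm₁ hm₀ hm using fun b => exists_meet hc r (c b true : V) (c b false)
  have hmc : ∀ b i, Between T r (m b) (c b i) := fun b i => by cases i <;> simp [hm₁, hm₀]
  have hbm : ∀ b : B, Between T r (b : V) (m b) := fun b => hm b b (hbc b true) (hbc b false)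
  have hnot : ∀ b i j, i ≠ j → ¬ Between T r (c b i : V) (m (c b j)) := fun b i j hij h =>
    (h.total hc (hbm (c b j))).elim (hcc b i j hij) (hcc b j i hij.symm)
  have hfold : ∀ s i, (s ++ [i]).foldl c ⟨b₀, hb₀⟩ = c (s.foldl c ⟨b₀, hb₀⟩) i := fun s i => by
    simp
  refine ⟨fun s => m (s.foldl c ⟨b₀, hb₀⟩), fun s i => ?_, fun s i heq => ?_, fun s x hx => ?_⟩
  · rw [hfold]
    exact (hmc _ i).trans (hbm _)
  · rw [hfold] at heq
    exact hnot _ i (!i) (by simp) (((hbm _).trans (heq ▸ hmc _ (!i))).trans (hbm _))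
  · simp only [hfold] at hx
    have hxc : ∀ i, Between T r x (c (s.foldl c ⟨b₀, hb₀⟩) i) := fun i =>
      ((hx i).total hc (hbm _)).resolve_right fun h => hnot _ i (!i) (by simp) (h.trans (hx _))
    exact hm _ x (hxc true) (hxc false)

theorem isPrefix_or_isPrefix_or_fork {α : Type*} (s t : List α) :
    s <+: t ∨ t <+: s ∨ ∃ u b c s' t', b ≠ c ∧ s = u ++ b :: s' ∧ t = u ++ c :: t' := by
  induction s generalizing t with
  | nil => exact Or.inl ⟨_, rfl⟩
  | cons a s ih =>
    cases t with
    | nil => exact Or.inr (Or.inl ⟨_, rfl⟩)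
    | cons b t =>
      rcases eq_or_ne a b with rfl | hab
      · rcases ih t with h | h | ⟨u, b, c, s', t', hne, rfl, rfl⟩
        · exact Or.inl (by simpa using h)
        · exact Or.inr (Or.inl (by simpa using h))
        · exact Or.inr (Or.inr ⟨a :: u, b, c, s', t', hne, rfl, rfl⟩)
      · exact Or.inr (Or.inr ⟨[], a, b, s, t, hab, rfl, rfl⟩)

namespace BinaryMap

variable (g : BinaryMap T r)

theorem between_append (s t : List Bool) : Between T r (g.vertex s) (g.vertex (s ++ t)) := by
  induction t using List.reverseRecOn with
  | nil => simpa using Between.refl _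
  | append_singleton t b ih =>
    rw [← List.append_assoc]
    exact ih.trans (g.between _ b)

theorem between_append_cons (s : List Bool) (b : Bool) (t : List Bool) :
    Between T r (g.vertex (s ++ [b])) (g.vertex (s ++ b :: t)) := by
  simpa using g.between_append (s ++ [b]) t

theorem vertex_ne_append_cons (hc : T.Preconnected) (s : List Bool) (b : Bool) (t : List Bool) :
    g.vertex s ≠ g.vertex (s ++ b :: t) := fun h =>
  g.vertex_ne s b ((g.between s b).antisymm hc (h ▸ g.between_append_cons s b t))

theorem between_of_ne {s : List Bool} {b c : Bool} (hbc : b ≠ c) {x : V}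
    (hxb : Between T r x (g.vertex (s ++ [b]))) (hxc : Between T r x (g.vertex (s ++ [c]))) :
    Between T r x (g.vertex s) := by
  have hdich : ∀ b c d : Bool, b ≠ c → d = b ∨ d = c := by decide
  refine g.meet s x fun d => ?_
  rcases hdich b c d hbc with rfl | rfl
  exacts [hxb, hxc]

theorem not_between_append_cons (hc : T.Preconnected) {u : List Bool} {b c : Bool} (hbc : b ≠ c)
    (t : List Bool) : ¬ Between T r (g.vertex (u ++ [b])) (g.vertex (u ++ c :: t)) := by
  intro h
  rcases h.total hc (g.between_append_cons u c t) with h' | h'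
  · exact g.vertex_ne u b ((g.between u b).antisymm hc (g.between_of_ne hbc (.refl _) h'))
  · exact g.vertex_ne u c ((g.between u c).antisymm hc (g.between_of_ne hbc h' (.refl _)))

theorem between_of_fork (hc : T.Preconnected) {u s t : List Bool} {b c : Bool} (hbc : b ≠ c)
    {x : V} (hs : Between T r x (g.vertex (u ++ b :: s)))
    (ht : Between T r x (g.vertex (u ++ c :: t))) : Between T r x (g.vertex u) :=
  g.between_of_ne hbc
    ((hs.total hc (g.between_append_cons u b s)).resolve_right fun h =>
      g.not_between_append_cons hc hbc t (h.trans ht))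
    ((ht.total hc (g.between_append_cons u c t)).resolve_right fun h =>
      g.not_between_append_cons hc hbc.symm s (h.trans hs))

theorem between_vertex_vertex_iff (hc : T.Preconnected) {s t : List Bool} :
    Between T r (g.vertex s) (g.vertex t) ↔ s <+: t := by
  constructor
  · intro h
    rcases isPrefix_or_isPrefix_or_fork s t with hst | ⟨_ | ⟨b, u⟩, rfl⟩ |
      ⟨u, b, c, s', t', hne, rfl, rfl⟩
    · exact hst
    · simp
    · exact absurd ((g.between_append t _).antisymm hc h) (g.vertex_ne_append_cons hc t b u)
    · exact absurd ((g.between_append u _).antisymm hc (g.between_of_fork hc hne (.refl _) h))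
        (g.vertex_ne_append_cons hc u b s')
  · rintro ⟨u, rfl⟩
    exact g.between_append s u

theorem vertex_injective (hc : T.Preconnected) : Function.Injective g.vertex := by
  intro s t h
  have hst : s <+: t := (g.between_vertex_vertex_iff hc).1 (h ▸ .refl _)
  have hts : t <+: s := (g.between_vertex_vertex_iff hc).1 (h ▸ .refl _)
  exact hst.eq_of_length_le hts.length_le

/-- The set of all vertices between copies of vertices of the binary tree. -/
def hull : Set V := {x | Between T r (g.vertex []) x ∧ ∃ s, Between T r x (g.vertex s)}

theorem rootedAt_hull : RootedAt T r (g.vertex []) g.hull where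
  mem := ⟨.refl _, [], .refl _⟩
  between _ hx := hx.1
  mem_of_between := fun _ ⟨_, s, hs⟩ _ hy hyx => ⟨hy, s, hyx.trans hs⟩

theorem exists_segment (hc : T.Preconnected) {x : V} (hx : x ∈ g.hull)
    (hne : x ≠ g.vertex []) : ∃ s b, Between T r (g.vertex s) x ∧
      Between T r x (g.vertex (s ++ [b])) ∧ x ≠ g.vertex s := by
  obtain ⟨hr, s, hs⟩ := hx
  induction s using List.reverseRecOn with
  | nil => exact absurd (hs.antisymm hc hr) hne
  | append_singleton s b ih =>
    by_cases hxs : Between T r x (g.vertex s)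
    · exact ih hxs
    · refine ⟨s, b, (hs.total hc (g.between s b)).resolve_left hxs, hs, ?_⟩
      rintro rfl
      exact hxs (.refl _)

theorem eq_or_eq_of_mem_segments (hc : T.Preconnected) {s t : List Bool} {b c : Bool}
    (hne : s ++ [b] ≠ t ++ [c]) {x : V} (hsx : Between T r (g.vertex s) x)
    (hxs : Between T r x (g.vertex (s ++ [b]))) (htx : Between T r (g.vertex t) x)
    (hxt : Between T r x (g.vertex (t ++ [c]))) : x = g.vertex s ∨ x = g.vertex (s ++ [b]) := by
  rcases isPrefix_or_isPrefix_or_fork (s ++ [b]) (t ++ [c]) with h | h |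
    ⟨u, d, e, s', t', hde, hs, ht⟩
  · have hst : s ++ [b] <+: t := (List.prefix_concat_iff.1 h).resolve_left hne
    exact Or.inr (hxs.antisymm hc (((g.between_vertex_vertex_iff hc).2 hst).trans htx))
  · have hts : t ++ [c] <+: s := (List.prefix_concat_iff.1 h).resolve_left hne.symm
    exact Or.inl ((hxt.trans ((g.between_vertex_vertex_iff hc).2 hts)).antisymm hc hsx)
  · have hxu : Between T r x (g.vertex u) := g.between_of_fork hc hde (hs ▸ hxs) (ht ▸ hxt)
    have hus : u <+: s := by
      refine (List.prefix_concat_iff.1 (show u <+: s ++ [b] from ⟨_, hs.symm⟩)).resolve_left ?_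
      intro h
      simpa using congrArg List.length (h.trans hs)
    exact Or.inl ((hxu.trans ((g.between_vertex_vertex_iff hc).2 hus)).antisymm hc hsx)

theorem exists_between_iff_of_adj (hc : T.Preconnected) {u v : List Bool}
    (h : binaryTree.Adj u v) : ∃ s b, s(u, v) = s(s, s ++ [b]) ∧
      ∀ x, Between T (g.vertex u) x (g.vertex v) ↔
        Between T r (g.vertex s) x ∧ Between T r x (g.vertex (s ++ [b])) := by
  rcases exists_append_of_binaryTree_adj h with ⟨b, rfl⟩ | ⟨b, rfl⟩
  · exact ⟨u, b, rfl, fun x => (g.between u b).between_iff hc⟩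
  · exact ⟨v, b, Sym2.eq_swap, fun x =>
      ⟨fun hx => ((g.between v b).between_iff hc).1 hx.symm,
        fun hx => (((g.between v b).between_iff hc).2 hx).symm⟩⟩

theorem eq_or_eq_of_between (hc : T.Preconnected) {u v x : List Bool} (h : binaryTree.Adj u v)
    (hx : Between T (g.vertex u) (g.vertex x) (g.vertex v)) : x = u ∨ x = v := by
  obtain ⟨s, b, huv, hb⟩ := g.exists_between_iff_of_adj hc h
  rw [hb, g.between_vertex_vertex_iff hc, g.between_vertex_vertex_iff hc,
    List.prefix_concat_iff] at hx
  rw [← Sym2.mem_iff, huv, Sym2.mem_iff]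
  exact hx.2.symm.imp_left fun hxs => hxs.eq_of_length_le hx.1.length_le

theorem eq_or_eq_of_between_of_between (hc : T.Preconnected) {u v u' v' : List Bool} {x : V}
    (h : binaryTree.Adj u v) (h' : binaryTree.Adj u' v') (hne : s(u, v) ≠ s(u', v'))
    (hx : Between T (g.vertex u) x (g.vertex v))
    (hx' : Between T (g.vertex u') x (g.vertex v')) : x = g.vertex u ∨ x = g.vertex v := by
  obtain ⟨s, b, huv, hb⟩ := g.exists_between_iff_of_adj hc h
  obtain ⟨t, c, huv', hc'⟩ := g.exists_between_iff_of_adj hc h'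
  rw [hb] at hx
  rw [hc'] at hx'
  have hst : s ++ [b] ≠ t ++ [c] := by
    intro h
    obtain ⟨rfl, -⟩ := List.append_inj' h rfl
    exact hne (by rw [huv, huv', h])
  have := g.eq_or_eq_of_mem_segments hc hst hx.1 hx.2 hx'.1 hx'.2
  rcases Sym2.eq_iff.1 huv with ⟨rfl, rfl⟩ | ⟨rfl, rfl⟩
  exacts [this, this.symm]

theorem exists_adj_of_mem_hull (hc : T.Preconnected) {x : V} (hx : x ∈ g.hull) :
    ∃ u v, binaryTree.Adj u v ∧ Between T (g.vertex u) x (g.vertex v) := by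
  rcases eq_or_ne x (g.vertex []) with rfl | hne
  · exact ⟨[], [true], binaryTree_adj_append [] true, root_between _⟩
  · obtain ⟨s, b, hsx, hxs, -⟩ := g.exists_segment hc hx hne
    exact ⟨s, s ++ [b], binaryTree_adj_append s b, ((g.between s b).between_iff hc).2 ⟨hsx, hxs⟩⟩

theorem exists_adj_of_isChild (hc : T.Preconnected) {x y : V} (hx : x ∈ g.hull) (hy : y ∈ g.hull)
    (h : IsChild T r x y) : ∃ u v, binaryTree.Adj u v ∧
      Between T (g.vertex u) x (g.vertex v) ∧ Between T (g.vertex u) y (g.vertex v) := by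
  have hne : y ≠ g.vertex [] := fun e => h.1.ne (h.2.antisymm hc (e ▸ hx.1))
  obtain ⟨s, b, hsy, hys, hne'⟩ := g.exists_segment hc hy hne
  exact ⟨s, s ++ [b], binaryTree_adj_append s b,
    ((g.between s b).between_iff hc).2 ⟨hsy.of_adj hne'.symm h.1, h.2.trans hys⟩,
    ((g.between s b).between_iff hc).2 ⟨hsy, hys⟩⟩

theorem nonempty_subdivision (hc : T.Preconnected) (ha : T.IsAcyclic) :
    Nonempty (Subdivision binaryTree (T.induce g.hull)) := by
  have hH := g.rootedAt_hull.preconnected hc ha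
  have hiff : ∀ a x b : g.hull, Between (T.induce g.hull) a x b ↔ Between T (a : V) x b :=
    fun _ _ _ => (between_embedding_iff hH ha (Embedding.induce g.hull)).symm
  let f : List Bool → g.hull := fun s => ⟨g.vertex s, g.between_append [] s, s, .refl _⟩
  refine ⟨.ofBetween hH (ha.induce _) f
    (fun s t h => g.vertex_injective hc (congrArg Subtype.val h)) ?_ ?_ ?_ ?_⟩
  · intro u v x h hx
    exact g.eq_or_eq_of_between hc h ((hiff _ _ _).1 hx)
  · intro u v u' v' x h h' hne hx hx'
    rw [hiff] at hx hx'
    exact (g.eq_or_eq_of_between_of_between hc h h' hne hx hx').imp Subtype.ext Subtype.ext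
  · intro x
    simpa only [hiff] using g.exists_adj_of_mem_hull hc x.2
  · intro x y h
    simp only [hiff]
    rcases isChild_or_isChild_of_adj (r := r) hc ha (show T.Adj x y from h) with hxy | hyx
    · exact g.exists_adj_of_isChild hc x.2 y.2 hxy
    · obtain ⟨u, v, huv, hy, hx⟩ := g.exists_adj_of_isChild hc y.2 x.2 hyx
      exact ⟨u, v, huv, hx, hy⟩

end BinaryMap

end BinaryMap

theorem isScattered_iff_not_branching {V : Type u} {T : SimpleGraph V} (r : V)
    (hc : T.Preconnected) (ha : T.IsAcyclic) : IsScattered T ↔ ¬ Branching T r := by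
  constructor
  · intro h hB
    obtain ⟨g⟩ := hB.exists_binaryMap hc
    exact (h _ _ (g.nonempty_subdivision hc ha)).false (Embedding.induce g.hull)
  · exact fun h W H ⟨S⟩ => ⟨fun f => h (branching_of_between hc _
      (f.injective.comp S.branch_injective) fun _ _ _ => S.between ha f)⟩

/-! ## Rays and ends -/

section Sequences

variable {V : Type*} {T : SimpleGraph V} {r : V} {x : ℕ → V}

theorem exists_seq_isChild {A : Set V} (hA : ∀ v ∈ A, ∃ c ∈ A, IsChild T r v c) {v : V}
    (hv : v ∈ A) :
    ∃ x : ℕ → V, x 0 = v ∧ (∀ n, x n ∈ A) ∧ ∀ n, IsChild T r (x n) (x (n + 1)) := by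
  choose! f hf hchild using hA
  have hmem (n : ℕ) : f^[n] v ∈ A := Set.MapsTo.iterate hf n hv
  refine ⟨fun n => f^[n] v, rfl, hmem, fun n => ?_⟩
  simpa only [Function.iterate_succ_apply'] using hchild _ (hmem n)

theorem between_of_le_of_isChild (hx : ∀ n, IsChild T r (x n) (x (n + 1))) {m n : ℕ}
    (hmn : m ≤ n) : Between T r (x m) (x n) :=
  Nat.rel_of_forall_rel_succ_of_le (Between T r) (fun n => (hx n).2) hmn

theorem injective_of_isChild (hc : T.Preconnected) (hx : ∀ n, IsChild T r (x n) (x (n + 1))) :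
    Function.Injective x :=
  .of_comp (f := T.dist r) (strictMono_nat_of_lt_succ fun n =>
    (hx n).2.dist_lt hc (hx n).1.ne).injective

end Sequences

namespace Ray

variable {V : Type u} {T : SimpleGraph V} {r : V}

/-- The part of a ray from its `k`-th vertex on. -/
def tail (C : Ray T) (k : ℕ) : Ray T where
  vertex n := C.vertex (n + k)
  injective := C.injective.comp (add_left_injective k)
  adj n := by simpa only [Nat.add_right_comm] using C.adj (n + k)

/-- The ray obtained from a ray by adding a new origin. -/
def cons (C : Ray T) (x : V) (h : T.Adj x (C.vertex 0)) (hx : x ∉ C.verts) : Ray T where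
  vertex n := Nat.casesOn n x C.vertex
  injective := by
    rintro (_ | m) (_ | n) e
    · rfl
    · exact absurd ⟨n, e.symm⟩ hx
    · exact absurd ⟨m, e⟩ hx
    · exact congrArg _ (C.injective e)
  adj
    | 0 => h
    | n + 1 => C.adj n

theorem toEnd_eq_iff {C D : Ray T} :
    C.toEnd = D.toEnd ↔ ∃ F : Set V, F.Finite ∧ C.verts \ F = D.verts \ F :=
  Quotient.eq

theorem toEnd_tail (C : Ray T) (k : ℕ) : (C.tail k).toEnd = C.toEnd := by
  refine toEnd_eq_iff.2 ⟨C.vertex '' Set.Iio k, (Set.finite_Iio k).image _, ?_⟩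
  ext x
  constructor
  · rintro ⟨⟨n, rfl⟩, hx⟩
    exact ⟨⟨n + k, rfl⟩, hx⟩
  · rintro ⟨⟨n, rfl⟩, hx⟩
    have hkn : k ≤ n := not_lt.1 fun h => hx ⟨n, h, rfl⟩
    exact ⟨⟨n - k, congrArg C.vertex (Nat.sub_add_cancel hkn)⟩, hx⟩

theorem toEnd_cons (C : Ray T) (x : V) (h : T.Adj x (C.vertex 0)) (hx : x ∉ C.verts) :
    (C.cons x h hx).toEnd = C.toEnd :=
  ((C.cons x h hx).toEnd_tail 1).symm

theorem eventually_notMem (C : Ray T) {F : Set V} (hF : F.Finite) :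
    ∀ᶠ n in atTop, C.vertex n ∉ F := by
  rw [← Nat.cofinite_eq_atTop]
  exact C.injective.tendsto_cofinite.eventually hF.compl_mem_cofinite

theorem eventually_mem_verts {C D : Ray T} (h : C.toEnd = D.toEnd) :
    ∀ᶠ n in atTop, C.vertex n ∈ D.verts := by
  obtain ⟨F, hF, hCD⟩ := toEnd_eq_iff.1 h
  filter_upwards [C.eventually_notMem hF] with n hn
  exact (hCD.subset ⟨⟨n, rfl⟩, hn⟩).1

theorem mem_verts_of_between {C : Ray T} (hC : C.vertex 0 = r) {s : V} {n : ℕ}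
    (h : Between T r s (C.vertex n)) : s ∈ C.verts := by
  induction n with
  | zero =>
    subst hC
    exact ⟨0, (List.mem_singleton.1 (h .nil)).symm⟩
  | succ n ih =>
    by_cases hs : s = C.vertex (n + 1)
    · exact ⟨n + 1, hs.symm⟩
    · exact ih (h.of_adj hs (C.adj n))

theorem isChild (hc : T.Preconnected) (ha : T.IsAcyclic) {C : Ray T} (hC : C.vertex 0 = r)
    (n : ℕ) : IsChild T r (C.vertex n) (C.vertex (n + 1)) := by
  induction n with
  | zero => exact ⟨C.adj 0, hC ▸ root_between _⟩
  | succ n ih =>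
    refine (isChild_or_isChild_of_adj hc ha (C.adj (n + 1))).resolve_right fun h => ?_
    have := C.injective (ih.parent_unique hc h)
    omega

theorem eventually_between (hc : T.Preconnected) (ha : T.IsAcyclic) {C D : Ray T}
    (hD : D.vertex 0 = r) (hCD : ∀ᶠ n in atTop, C.vertex n ∈ D.verts) {s : V} (hs : s ∈ D.verts) :
    ∀ᶠ n in atTop, Between T r s (C.vertex n) := by
  obtain ⟨k, rfl⟩ := hs
  filter_upwards [hCD, C.eventually_notMem ((Set.finite_Iio k).image D.vertex)] with n hn hnk
  obtain ⟨m, hm⟩ := hn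
  have hkm : k ≤ m := not_lt.1 fun h => hnk ⟨m, h, hm⟩
  exact hm ▸ between_of_le_of_isChild (isChild hc ha hD) hkm

theorem toEnd_eq_of_verts_subset (hc : T.Preconnected) (ha : T.IsAcyclic) {C D : Ray T}
    (hC : C.vertex 0 = r) (hD : D.vertex 0 = r) (h : C.verts ⊆ D.verts) : C.toEnd = D.toEnd := by
  refine toEnd_eq_iff.2 ⟨∅, Set.finite_empty, ?_⟩
  rw [h.antisymm fun s hs => ?_]
  obtain ⟨n, hn⟩ := (eventually_between hc ha hD (.of_forall fun n => h ⟨n, rfl⟩) hs).exists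
  exact mem_verts_of_between hC hn

end Ray

section Ends

variable {V : Type u} {T : SimpleGraph V} {r s t : V} {e e' : Ends T}

theorem exists_ray_from (hc : T.Preconnected) (r : V) (e : Ends T) :
    ∃ C : Ray T, C.vertex 0 = r ∧ C.toEnd = e := by
  obtain ⟨C, rfl⟩ := Quotient.exists_rep e
  obtain ⟨p⟩ := hc r (C.vertex 0)
  generalize hx : C.vertex 0 = x at p
  induction p with
  | nil => exact ⟨C, hx, rfl⟩
  | @cons y z _ hyz p ih =>
    obtain ⟨D, rfl, hDC⟩ := ih hx
    by_cases hy : y ∈ D.verts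
    · obtain ⟨k, rfl⟩ := hy
      exact ⟨D.tail k, congrArg D.vertex (zero_add k), (D.toEnd_tail k).trans hDC⟩
    · exact ⟨D.cons y hyz hy, rfl, (D.toEnd_cons y hyz hy).trans hDC⟩

theorem toEnd_mem_endsThrough_iff (hc : T.Preconnected) (ha : T.IsAcyclic) {C : Ray T} :
    C.toEnd ∈ endsThrough T r s ↔ ∀ᶠ n in atTop, Between T r s (C.vertex n) := by
  constructor
  · rintro ⟨D, hDC, hD, hs⟩
    exact Ray.eventually_between hc ha hD (Ray.eventually_mem_verts hDC.symm) hs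
  · intro h
    obtain ⟨D, hD, hDC⟩ := exists_ray_from hc r C.toEnd
    obtain ⟨n, hn, m, hm⟩ := (h.and (Ray.eventually_mem_verts hDC.symm)).exists
    exact ⟨D, hDC, hD, Ray.mem_verts_of_between hD (hm ▸ hn)⟩

theorem mem_endsThrough_self (hc : T.Preconnected) (r : V) (e : Ends T) :
    e ∈ endsThrough T r r := by
  obtain ⟨C, hC, rfl⟩ := exists_ray_from hc r e
  exact ⟨C, rfl, hC, 0, hC⟩

theorem endsThrough_subset_endsThrough (h : Between T r s t) :
    endsThrough T r t ⊆ endsThrough T r s := by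
  rintro _ ⟨C, rfl, hC, n, rfl⟩
  exact ⟨C, rfl, hC, Ray.mem_verts_of_between hC h⟩

theorem between_or_between_of_mem_endsThrough (hc : T.Preconnected) (ha : T.IsAcyclic)
    (hs : e ∈ endsThrough T r s) (ht : e ∈ endsThrough T r t) :
    Between T r s t ∨ Between T r t s := by
  obtain ⟨C, rfl⟩ := Quotient.exists_rep e
  obtain ⟨n, hn⟩ := (((toEnd_mem_endsThrough_iff hc ha).1 hs).and
    ((toEnd_mem_endsThrough_iff hc ha).1 ht)).exists
  exact hn.1.total hc hn.2

theorem exists_mem_endsThrough_notMem (hc : T.Preconnected) (ha : T.IsAcyclic) (r : V)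
    (hne : e ≠ e') : ∃ s, e ∈ endsThrough T r s ∧ e' ∉ endsThrough T r s := by
  by_contra! h
  obtain ⟨C, hC, rfl⟩ := exists_ray_from hc r e
  obtain ⟨D, hD, rfl⟩ := exists_ray_from hc r e'
  refine hne (Ray.toEnd_eq_of_verts_subset hc ha hC hD fun s hs => ?_)
  obtain ⟨n, hn, m, hm⟩ := (((toEnd_mem_endsThrough_iff hc ha).1 (h s ⟨C, rfl, hC, hs⟩)).and
    (Ray.eventually_mem_verts rfl)).exists
  exact Ray.mem_verts_of_between hD (hm ▸ hn)

theorem exists_endsThrough_subset_endsThrough (hc : T.Preconnected) (ha : T.IsAcyclic) (r : V)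
    (he : e ∈ endsThrough T s t) :
    ∃ u, e ∈ endsThrough T r u ∧ endsThrough T r u ⊆ endsThrough T s t := by
  obtain ⟨C, hC, rfl⟩ := exists_ray_from hc r e
  obtain ⟨p⟩ := hc r s
  obtain ⟨n, hn, hnp⟩ := (((toEnd_mem_endsThrough_iff hc ha).1 he).and
    (C.eventually_notMem p.support.finite_toSet)).exists
  refine ⟨C.vertex n, ⟨C, rfl, hC, n, rfl⟩, fun e' he' => ?_⟩
  obtain ⟨D, rfl⟩ := Quotient.exists_rep e'
  refine (toEnd_mem_endsThrough_iff hc ha).2 ?_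
  filter_upwards [(toEnd_mem_endsThrough_iff hc ha).1 he'] with m hm
  exact hn.trans ((hm.between_or_between s).resolve_left fun h => hnp (h.symm p))

theorem exists_endsThrough_subset (hc : T.Preconnected) (ha : T.IsAcyclic) (r : V)
    {U : Set (Ends T)} (hU : IsOpen U) (he : e ∈ U) :
    ∃ s, e ∈ endsThrough T r s ∧ endsThrough T r s ⊆ U := by
  induction hU with
  | basic U h =>
    obtain ⟨s, t, rfl⟩ := h
    exact exists_endsThrough_subset_endsThrough hc ha r he
  | univ => exact ⟨r, mem_endsThrough_self hc r e, Set.subset_univ _⟩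
  | inter U₁ U₂ _ _ ih₁ ih₂ =>
    obtain ⟨s₁, he₁, hs₁⟩ := ih₁ he.1
    obtain ⟨s₂, he₂, hs₂⟩ := ih₂ he.2
    rcases between_or_between_of_mem_endsThrough hc ha he₁ he₂ with h | h
    · exact ⟨s₂, he₂, Set.subset_inter ((endsThrough_subset_endsThrough h).trans hs₁) hs₂⟩
    · exact ⟨s₁, he₁, Set.subset_inter hs₁ ((endsThrough_subset_endsThrough h).trans hs₂)⟩
  | sUnion 𝒰 _ ih =>
    obtain ⟨U, hU, heU⟩ := he
    obtain ⟨s, hes, hs⟩ := ih U hU heU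
    exact ⟨s, hes, hs.trans (Set.subset_sUnion_of_mem hU)⟩

theorem exists_mem_endsThrough_forall_mem (hc : T.Preconnected) (ha : T.IsAcyclic) {A : Set V}
    (hA : ∀ v ∈ A, ∀ w, Between T r w v → w ∈ A) (hA' : ∀ v ∈ A, ∃ c ∈ A, IsChild T r v c)
    {v : V} (hv : v ∈ A) :
    ∃ e ∈ endsThrough T r v, ∀ s, e ∈ endsThrough T r s → s ∈ A := by
  obtain ⟨x, rfl, hxA, hx⟩ := exists_seq_isChild hA' hv
  let C : Ray T := ⟨x, injective_of_isChild hc hx, fun n => (hx n).1⟩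
  refine ⟨C.toEnd, (toEnd_mem_endsThrough_iff hc ha).2
    (.of_forall fun n => between_of_le_of_isChild hx n.zero_le), fun s hs => ?_⟩
  obtain ⟨n, hn⟩ := ((toEnd_mem_endsThrough_iff hc ha).1 hs).exists
  exact hA _ (hxA n) s hn

theorem topologicallyScattered_of_not_branching (hc : T.Preconnected) (ha : T.IsAcyclic)
    (h : ¬ Branching T r) : TopologicallyScattered (Ends T) := by
  rintro S ⟨e₀, he₀⟩
  by_contra! hn
  refine h ⟨{v | ∃ e ∈ S, e ∈ endsThrough T r v}, ⟨r, e₀, he₀, mem_endsThrough_self hc r e₀⟩, ?_⟩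
  rintro v ⟨e, he, hev⟩
  obtain ⟨e', ⟨hev', he'⟩, hne⟩ : ∃ e' ∈ endsThrough T r v ∩ S, e' ≠ e := by
    by_contra! hall
    exact hn e he _ (TopologicalSpace.isOpen_generateFrom_of_mem ⟨r, v, rfl⟩)
      (Set.eq_singleton_iff_unique_mem.2 ⟨⟨hev, he⟩, hall⟩)
  obtain ⟨s, hes, hes'⟩ := exists_mem_endsThrough_notMem hc ha r hne.symm
  obtain ⟨t, het', het⟩ := exists_mem_endsThrough_notMem hc ha r hne
  have hvs : Between T r v s := (between_or_between_of_mem_endsThrough hc ha hev hes).resolve_right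
    fun h => hes' (endsThrough_subset_endsThrough h hev')
  have hvt : Between T r v t :=
    (between_or_between_of_mem_endsThrough hc ha hev' het').resolve_right
      fun h => het (endsThrough_subset_endsThrough h hev)
  exact ⟨s, ⟨e, he, hes⟩, t, ⟨e', he', het'⟩, hvs, hvt,
    fun h => hes' (endsThrough_subset_endsThrough h het'),
    fun h => het (endsThrough_subset_endsThrough h hes)⟩

theorem not_branching_of_topologicallyScattered (hc : T.Preconnected) (ha : T.IsAcyclic) (r : V)
    (h : TopologicallyScattered (Ends T)) : ¬ Branching T r := by
  rintro ⟨B, ⟨b₀, hb₀⟩, hB⟩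
  have hchild : ∀ v ∈ {v | ∃ b ∈ B, Between T r v b},
      ∃ c ∈ {v | ∃ b ∈ B, Between T r v b}, IsChild T r v c := by
    rintro v ⟨b, hb, hvb⟩
    obtain ⟨x, hx, y, -, hbx, hby, hxy, -⟩ := hB b hb
    obtain ⟨c, hvc, hcx⟩ := exists_isChild_between hc ha (hvb.trans hbx)
      fun hvx => hxy (hvx ▸ hvb.trans hby)
    exact ⟨c, ⟨x, hx, hcx⟩, hvc⟩
  have hend : ∀ b ∈ B, ∃ e ∈ endsThrough T r b,
      ∀ s, e ∈ endsThrough T r s → ∃ b ∈ B, Between T r s b := fun b hb =>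
    exists_mem_endsThrough_forall_mem (A := {v | ∃ b ∈ B, Between T r v b}) hc ha
      (fun _ ⟨c, hc, hvc⟩ _ hwv => ⟨c, hc, hwv.trans hvc⟩) hchild ⟨b, hb, .refl b⟩
  obtain ⟨e₀, -, he₀⟩ := hend b₀ hb₀
  obtain ⟨e, he, U, hU, hUS⟩ := h
    {e | ∀ s, e ∈ endsThrough T r s → ∃ b ∈ B, Between T r s b} ⟨e₀, he₀⟩
  obtain ⟨s, hes, hsU⟩ := exists_endsThrough_subset hc ha r hU (hUS.superset rfl).1
  obtain ⟨b, hb, hsb⟩ := he s hes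
  obtain ⟨x, hx, y, hy, hbx, hby, hxy, hyx⟩ := hB b hb
  have hmem : ∀ x ∈ B, Between T r b x → e ∈ endsThrough T r x := by
    intro x hx hbx
    obtain ⟨e', hex, he'⟩ := hend x hx
    obtain rfl : e' = e :=
      hUS.subset ⟨hsU (endsThrough_subset_endsThrough (hsb.trans hbx) hex), he'⟩
    exact hex
  exact (between_or_between_of_mem_endsThrough hc ha (hmem x hx hbx) (hmem y hy hby)).elim hxy hyx

theorem topologicallyScattered_iff_not_branching (hc : T.Preconnected) (ha : T.IsAcyclic) (r : V) :
    TopologicallyScattered (Ends T) ↔ ¬ Branching T r :=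
  ⟨not_branching_of_topologicallyScattered hc ha r, topologicallyScattered_of_not_branching hc ha⟩

end Ends

/-! ## Members of the hierarchy have no branching sets -/

/-- In the tree `T` with root `r`, the set `A` is attached to the rest of the tree at `ρ` only:
no other member of `A` has a neighbour outside `A` or is the root. -/
structure AttachedAt {V : Type*} (T : SimpleGraph V) (r ρ : V) (A : Set V) : Prop where
  eq_of_adj : ∀ a ∈ A, ∀ b ∉ A, T.Adj a b → a = ρ
  eq_of_root_mem : r ∈ A → r = ρ

namespace AttachedAt

variable {V : Type*} {T : SimpleGraph V} {r x y : V}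

theorem between {ρ : V} {A : Set V} (h : AttachedAt T r ρ A) (hx : x ∈ A) : Between T r ρ x := by
  intro p
  by_cases hr : r ∈ A
  · exact h.eq_of_root_mem hr ▸ p.start_mem_support
  · obtain ⟨d, hd, hd₁, hd₂⟩ := p.exists_boundary_dart Aᶜ hr (not_not.2 hx)
    rw [← h.eq_of_adj _ (not_not.1 hd₂) _ hd₁ d.adj.symm]
    exact p.dart_snd_mem_support_of_mem_darts hd

theorem mem_of_between {ρ : V} {A : Set V} (h : AttachedAt T r ρ A) (hc : T.Preconnected)
    (hx : x ∈ A) (hne : x ≠ ρ) (hxy : Between T r x y) : y ∈ A := by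
  by_contra hy
  have hρ : Between T x ρ y := by
    intro p
    obtain ⟨d, hd, hd₁, hd₂⟩ := p.exists_boundary_dart A hx hy
    rw [← h.eq_of_adj _ hd₁ _ hd₂ d.adj]
    exact p.dart_fst_mem_support_of_mem_darts hd
  exact hne (((hxy.between_iff hc).1 hρ).1.antisymm hc (h.between hx))

variable {W : Type*} {F : SimpleGraph W} {ρ : W} {e : F ↪g T}

theorem between_iff (h : AttachedAt T r (e ρ) (Set.range e)) (hc : T.Preconnected)
    (ha : T.IsAcyclic) (hF : F.Preconnected) {y z : W} :
    Between T r (e y) (e z) ↔ Between F ρ y z := by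
  rw [← between_embedding_iff hF ha e, (h.between ⟨z, rfl⟩).between_iff hc]
  exact (and_iff_right (h.between ⟨y, rfl⟩)).symm

theorem branching (h : AttachedAt T r (e ρ) (Set.range e)) (hc : T.Preconnected)
    (ha : T.IsAcyclic) (hF : F.Preconnected) {B : Set V}
    (hB : ∀ b ∈ B, ∃ c ∈ B, ∃ d ∈ B,
      Between T r b c ∧ Between T r b d ∧ ¬ Between T r c d ∧ ¬ Between T r d c)
    {y : W} (hy : e y ∈ B) (hne : y ≠ ρ) : Branching F ρ := by
  have hrange : ∀ z, Between T r (e y) z → z ∈ Set.range e := fun z =>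
    h.mem_of_between hc ⟨y, rfl⟩ (e.injective.ne hne)
  refine ⟨{z | e z ∈ B ∧ Between T r (e y) (e z)}, ⟨y, hy, .refl _⟩, fun z ⟨hz, hyz⟩ => ?_⟩
  obtain ⟨c, hcB, d, hdB, hzc, hzd, hcd, hdc⟩ := hB _ hz
  obtain ⟨c, rfl⟩ := hrange c (hyz.trans hzc)
  obtain ⟨d, rfl⟩ := hrange d (hyz.trans hzd)
  simp only [← h.between_iff hc ha hF]
  exact ⟨c, ⟨hcB, hyz.trans hzc⟩, d, ⟨hdB, hyz.trans hzd⟩, hzc, hzd, hcd, hdc⟩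

end AttachedAt

theorem RootedTree.exists_root (T : RootedTree.{u}) (x : T.V) : ∃ r, T.root = some r :=
  Option.ne_none_iff_exists'.1 fun h => (T.isEmpty_of_root_eq_none h).false x

/-- The rooted tree has no branching set; this is the invariant of the classes `rootedClass α`. -/
def RootedTree.Unbranched (T : RootedTree.{u}) : Prop :=
  ∀ r, T.root = some r → ¬ Branching T.graph r

/-- A branching set is not a chain, hence one of its members is a non-root vertex of some `F i`,
where the branching persists. -/
theorem not_branching_of_isChain {V : Type*} {T : SimpleGraph V} {r : V} (hc : T.Preconnected)
    (ha : T.IsAcyclic) {I : Type*} {F : I → RootedTree.{u}} (hF : ∀ i, (F i).Unbranched)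
    (e : ∀ i, (F i).graph ↪g T)
    (he : ∀ i ρ, (F i).root = some ρ → AttachedAt T r (e i ρ) (Set.range (e i)))
    (hchain : IsChain (Between T r) {x | ∀ i y, e i y = x → (F i).root = some y}) :
    ¬ Branching T r := by
  rintro ⟨B, ⟨b, hb⟩, hB⟩
  obtain ⟨i, y, hy, hne⟩ : ∃ i y, e i y ∈ B ∧ (F i).root ≠ some y := by
    by_contra! hall
    obtain ⟨c, hcB, d, hdB, -, -, hcd, hdc⟩ := hB b hb
    exact (hchain.total (fun i y hy => hall i y (hy ▸ hcB))
      (fun i y hy => hall i y (hy ▸ hdB))).elim hcd hdc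
  obtain ⟨ρ, hρ⟩ := (F i).exists_root y
  exact hF i ρ hρ ((he i ρ hρ).branching hc ha (F i).preconnected hB hy
    fun h => hne (h ▸ hρ))

theorem IsSuc.unbranched {T T' : RootedTree.{u}} (h : IsSuc T T') (hT' : T'.Unbranched) :
    T.Unbranched := by
  obtain ⟨a, e, hroot, hne, hcov, hadj⟩ := h
  intro r hr
  obtain rfl : a = r := Option.some_injective _ (hroot.symm.trans hr)
  refine not_branching_of_isChain (I := Unit) T.preconnected T.isAcyclic (fun _ => hT')
    (fun _ => e) (fun _ ρ hρ => ⟨?_, ?_⟩) fun x hx y hy hxy => ?_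
  · rintro _ ⟨z, rfl⟩ b hb hzb
    obtain rfl := (hcov b).resolve_right hb
    exact congrArg e (Option.some_injective _ (((hadj z).1 hzb.symm).symm.trans hρ))
  · rintro ⟨z, hz⟩
    exact absurd hz (hne z)
  · rcases hcov x with rfl | ⟨x, rfl⟩
    · exact Or.inl (root_between y)
    rcases hcov y with rfl | ⟨y, rfl⟩
    · exact Or.inr (root_between _)
    · exact absurd (congrArg e (Option.some_injective _
        ((hx () x rfl).symm.trans (hy () y rfl)))) hxy

theorem IsSup.unbranched {T : RootedTree.{u}} {I : Type u} {F : I → RootedTree.{u}}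
    (h : IsSup T F) (hF : ∀ i, (F i).Unbranched) : T.Unbranched := by
  obtain ⟨e, hroot, hcov, hdisj, hadj⟩ := h
  intro r hr
  have hroot' : ∀ i ρ, (F i).root = some ρ → r = e i ρ := fun i ρ hρ =>
    Option.some_injective _ (hr.symm.trans (hroot i ρ hρ))
  refine not_branching_of_isChain T.preconnected T.isAcyclic hF e
    (fun i ρ hρ => ⟨?_, fun _ => hroot' i ρ hρ⟩) (Set.Subsingleton.isChain ?_)
  · rintro _ ⟨z, rfl⟩ b hb hzb
    obtain ⟨j, y, y', hy, rfl⟩ := hadj _ _ hzb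
    have hij : i ≠ j := fun hij => hb (by subst hij; exact ⟨y', rfl⟩)
    rw [← hroot' i ρ hρ]
    exact Option.some_injective _ ((hdisj i j z y hij hy.symm).symm.trans hr)
  · have heq : ∀ x, (∀ i y, e i y = x → (F i).root = some y) → r = x := fun x hx => by
      obtain ⟨i, y, rfl⟩ := hcov x
      exact hroot' i y (hx i y rfl)
    exact fun x hx y hy => (heq x hx).symm.trans (heq y hy)

theorem IsPathSum.unbranched {T : RootedTree.{u}} {F : ℕ → RootedTree.{u}}
    (h : IsPathSum T F) (hF : ∀ n, (F n).Unbranched) : T.Unbranched := by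
  obtain ⟨-, e, hroot, hcov, hdisj, hadj⟩ := h
  intro r hr
  obtain ⟨ρ₀, hρ₀, rfl⟩ := Option.map_eq_some_iff.1 (hroot.symm.trans hr)
  -- Used for a single summand and for all summands from some index on.
  have hattached : ∀ (N : Set ℕ) (m : ℕ) (ρ : (F m).V), (F m).root = some ρ →
      (∀ k ∈ N, ∀ l ∉ N, k = l + 1 ∨ l = k + 1 → k = m) → (0 ∈ N → 0 = m) →
      AttachedAt T.graph (e 0 ρ₀) (e m ρ) {x | ∃ k ∈ N, ∃ y, e k y = x} := by
    refine fun N m ρ hρ hN hN₀ => ⟨?_, ?_⟩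
    · rintro _ ⟨k, hk, y, rfl⟩ b hb hyb
      obtain ⟨l, z, rfl⟩ := hcov b
      have hl : l ∉ N := fun hl => hb ⟨l, hl, z, rfl⟩
      obtain ⟨hkl, hy, -⟩ := (hadj k l y z fun hkl => hl (hkl ▸ hk)).1 hyb
      obtain rfl := hN k hk l hl hkl.symm
      rw [Option.some_injective _ (hρ.symm.trans hy)]
    · rintro ⟨k, hk, y, hy⟩
      obtain rfl : 0 = k := not_not.1 fun hk₀ => hdisj 0 k ρ₀ y hk₀ hy.symm
      obtain rfl := hN₀ hk
      rw [Option.some_injective _ (hρ₀.symm.trans hρ)]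
  have hle : ∀ m n ρ ρ', (F m).root = some ρ → (F n).root = some ρ' → m ≤ n →
      Between T.graph (e 0 ρ₀) (e m ρ) (e n ρ') := fun m n ρ ρ' hρ _ hmn =>
    (hattached (Set.Ici m) m ρ hρ (by simp only [Set.mem_Ici]; lia)
      (by simp only [Set.mem_Ici]; lia)).between ⟨n, hmn, ρ', rfl⟩
  refine not_branching_of_isChain T.preconnected T.isAcyclic hF e (fun n ρ hρ => ?_)
    fun x hx y hy _ => ?_
  · convert hattached {n} n ρ hρ (fun k hk _ _ _ => hk) id
    simp [Set.range]
  · obtain ⟨m, x, rfl⟩ := hcov x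
    obtain ⟨n, y, rfl⟩ := hcov y
    exact (le_total m n).imp (hle m n x y (hx m x rfl) (hy n y rfl))
      (hle n m y x (hy n y rfl) (hx m x rfl))

theorem SucSupClosure.unbranched {X : Set RootedTree.{u}} (hX : ∀ T ∈ X, T.Unbranched)
    {T : RootedTree.{u}} (h : SucSupClosure X T) : T.Unbranched := by
  induction h with
  | base T hT => exact hX T hT
  | suc T T' h _ ih => exact h.unbranched ih
  | sup T I F h _ ih => exact h.unbranched ih

theorem unbranched_of_mem_rootedClass (α : Ordinal.{u}) :
    ∀ T ∈ rootedClass α, T.Unbranched := by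
  induction α using Ordinal.limitRecOn with
  | zero =>
    rw [rootedClass_zero]
    exact fun _ => SucSupClosure.unbranched fun T hT r _ => (hT.false r).elim
  | add_one β ih =>
    rw [rootedClass_add_one]
    refine fun _ => SucSupClosure.unbranched ?_
    rintro T ⟨F, hF, hT⟩
    exact hT.unbranched fun n => ih _ (hF n)
  | limit α h ih =>
    rw [rootedClass_limit α h]
    refine fun _ => SucSupClosure.unbranched ?_
    rintro T ⟨β, hβ, hT⟩
    exact ih β hβ T hT

/-! ## Closure properties of the hierarchy -/

theorem exists_rootedClass_eq (α : Ordinal.{u}) :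
    ∃ X : Set RootedTree.{u}, rootedClass α = {T | SucSupClosure X T} := by
  induction α using Ordinal.limitRecOn with
  | zero => exact ⟨_, rootedClass_zero⟩
  | add_one β _ => exact ⟨_, rootedClass_add_one β⟩
  | limit α h _ => exact ⟨_, rootedClass_limit α h⟩

theorem IsSuc.mem_rootedClass {α : Ordinal.{u}} {T T' : RootedTree.{u}} (h : IsSuc T T')
    (hT' : T' ∈ rootedClass α) : T ∈ rootedClass α := by
  obtain ⟨X, hX⟩ := exists_rootedClass_eq α
  rw [hX] at hT' ⊢
  exact .suc T T' h hT'

theorem IsSup.mem_rootedClass {α : Ordinal.{u}} {T : RootedTree.{u}} {I : Type u}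
    {F : I → RootedTree.{u}} (h : IsSup T F) (hF : ∀ i, F i ∈ rootedClass α) :
    T ∈ rootedClass α := by
  obtain ⟨X, hX⟩ := exists_rootedClass_eq α
  rw [hX] at hF ⊢
  exact .sup T I F h hF

theorem IsPathSum.mem_rootedClass {α : Ordinal.{u}} {T : RootedTree.{u}}
    {F : ℕ → RootedTree.{u}} (h : IsPathSum T F) (hF : ∀ n, F n ∈ rootedClass α) :
    T ∈ rootedClass (α + 1) := by
  rw [rootedClass_add_one]
  exact .base T ⟨F, hF, h⟩

/-- The empty tree, the starting point of the hierarchy. -/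
def emptyTree : RootedTree.{u} where
  V := PEmpty
  graph := ⊥
  preconnected x := x.elim
  isAcyclic := isAcyclic_bot
  root := none
  isEmpty_of_root_eq_none _ := inferInstance

/-- The embedding of the empty tree in a graph. -/
def emptyTreeEmbedding {V : Type*} (G : SimpleGraph V) : emptyTree.{u}.graph ↪g G :=
  ⟨⟨PEmpty.elim, fun x => x.elim⟩, fun {x} => x.elim⟩

theorem emptyTree_mem_rootedClass (α : Ordinal.{u}) : emptyTree ∈ rootedClass α :=
  IsSup.mem_rootedClass (I := PEmpty) (F := PEmpty.elim)
    ⟨fun i => i.elim, fun i => i.elim, fun x => x.elim, fun i => i.elim, fun x => x.elim⟩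
    fun i => i.elim

theorem isPathSum_single (T : RootedTree.{u}) :
    IsPathSum T fun n => n.casesOn T fun _ => emptyTree := by
  refine ⟨fun n _ => inferInstanceAs (IsEmpty PEmpty), fun n => match n with
    | 0 => .refl
    | _ + 1 => emptyTreeEmbedding _, (Option.map_id' (x := T.root)).symm,
    fun x => ⟨0, x, rfl⟩, ?_, ?_⟩ <;>
  · rintro (_ | m) (_ | n) y z h
    · exact absurd rfl h
    · exact z.elim
    · exact y.elim
    · exact y.elim

theorem rootedClass_mono {α β : Ordinal.{u}} (h : α ≤ β) :
    rootedClass α ⊆ rootedClass β := by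
  induction β using Ordinal.limitRecOn with
  | zero => rw [nonpos_iff_eq_zero.1 h]
  | add_one β ih =>
    rcases h.eq_or_lt with rfl | h
    · rfl
    · refine fun T hT => (isPathSum_single T).mem_rootedClass ?_
      rintro (_ | _)
      · exact ih (Order.lt_add_one_iff.1 h) hT
      · exact emptyTree_mem_rootedClass β
  | limit β hβ ih =>
    rcases h.eq_or_lt with rfl | h
    · rfl
    · intro T hT
      rw [rootedClass_limit β hβ]
      exact .base T ⟨α, h, hT⟩

/-! ## Decomposition of trees without branching sets -/

section Decomposition

variable {V : Type u} {T : SimpleGraph V} {r v : V}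

/-- The subtree spanned by a set `A` of vertices with least element `v`, rooted at `v`. -/
def RootedAt.tree {A : Set V} (h : RootedAt T r v A) (hc : T.Preconnected) (ha : T.IsAcyclic) :
    RootedTree.{u} where
  V := A
  graph := T.induce A
  preconnected := h.preconnected hc ha
  isAcyclic := ha.induce A
  root := some ⟨v, h.mem⟩
  isEmpty_of_root_eq_none h := by cases h

theorem rootedAt_above (v : V) : RootedAt T r v {x | Between T r v x} :=
  ⟨.refl v, fun _ h => h, fun _ _ _ h _ => h⟩

/-- The subtree of the vertices above `v` in the tree with root `r`, rooted at `v`. -/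
def treeAbove (hc : T.Preconnected) (ha : T.IsAcyclic) (r v : V) : RootedTree.{u} :=
  (rootedAt_above (r := r) v).tree hc ha

theorem rootedAt_singleton (hc : T.Preconnected) (v : V) : RootedAt T r v {v} where
  mem := rfl
  between := by
    rintro _ rfl
    exact .refl _
  mem_of_between := by
    rintro _ rfl x hvx hxv
    exact hxv.antisymm hc hvx

theorem IsChild.rootedAt_insert {c : V} (h : IsChild T r v c) (hc : T.Preconnected) :
    RootedAt T r v (insert v {x | Between T r c x}) where
  mem := Or.inl rfl
  between := by
    rintro _ (rfl | hx)
    exacts [.refl _, h.2.trans hx]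
  mem_of_between := by
    rintro a (rfl | hca) x hvx hxa
    · exact Or.inl (hxa.antisymm hc hvx)
    rcases hxa.total hc hca with hxc | hcx
    · by_cases hne : x = c
      · exact Or.inr (hne ▸ .refl x)
      · exact Or.inl ((hxc.of_adj hne h.1).antisymm hc hvx)
    · exact Or.inr hcx

theorem isSuc_singleton (hc : T.Preconnected) (ha : T.IsAcyclic) (v : V) :
    IsSuc ((rootedAt_singleton (T := T) (r := r) hc v).tree hc ha) emptyTree :=
  ⟨⟨v, rfl⟩, emptyTreeEmbedding _, rfl, fun y => y.elim,
    fun x => Or.inl (Subtype.ext x.2), fun y => y.elim⟩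

theorem IsChild.isSuc_insert {c : V} (h : IsChild T r v c) (hc : T.Preconnected)
    (ha : T.IsAcyclic) : IsSuc ((h.rootedAt_insert hc).tree hc ha) (treeAbove hc ha r c) := by
  refine ⟨⟨v, Or.inl rfl⟩, T.induceHomOfLE (Set.subset_insert _ _), rfl, ?_, ?_, ?_⟩
  · rintro ⟨y, hy⟩ hyv
    obtain rfl : y = v := congrArg Subtype.val hyv
    exact h.1.ne (h.2.antisymm hc hy)
  · rintro ⟨x, rfl | hx⟩
    · exact Or.inl rfl
    · exact Or.inr ⟨⟨x, hx⟩, rfl⟩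
  · rintro ⟨y, hy⟩
    constructor
    · intro (hvy : T.Adj v y)
      obtain rfl : c = y := not_not.1 fun hne =>
        h.1.ne (h.2.antisymm hc (Between.of_adj hy hne hvy))
      rfl
    · intro hcy
      obtain rfl : c = y := congrArg Subtype.val (Option.some_injective _ hcy)
      exact h.1

theorem RootedAt.isSup {A : Set V} (hA : RootedAt T r v A) (hc : T.Preconnected)
    (ha : T.IsAcyclic) {I : Type u} {B : I → Set V} (hB : ∀ i, RootedAt T r v (B i))
    (hBA : ∀ i, B i ⊆ A) (hcov : ∀ x ∈ A, ∃ i, x ∈ B i)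
    (hdisj : ∀ i j, i ≠ j → ∀ x ∈ B i, x ∈ B j → x = v)
    (hchild : ∀ x ∈ A, ∀ y ∈ A, IsChild T r x y → ∃ i, x ∈ B i ∧ y ∈ B i) :
    IsSup (hA.tree hc ha) fun i => (hB i).tree hc ha := by
  refine ⟨fun i => T.induceHomOfLE (hBA i), ?_, ?_, ?_, ?_⟩
  · intro i y hy
    obtain rfl := Option.some_injective _ hy
    rfl
  · rintro ⟨x, hx⟩
    obtain ⟨i, hi⟩ := hcov x hx
    exact ⟨i, ⟨x, hi⟩, rfl⟩
  · rintro i j ⟨y, hy⟩ ⟨z, hz⟩ hij hyz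
    obtain rfl : y = z := congrArg Subtype.val hyz
    obtain rfl := hdisj i j hij y hy hz
    rfl
  · rintro ⟨x, hx⟩ ⟨y, hy⟩ hxy
    obtain ⟨i, hxi, hyi⟩ : ∃ i, x ∈ B i ∧ y ∈ B i := by
      rcases isChild_or_isChild_of_adj (r := r) hc ha (show T.Adj x y from hxy) with h | h
      · exact hchild x hx y hy h
      · exact (hchild y hy x hx h).imp fun _ => And.symm
    exact ⟨i, ⟨x, hxi⟩, ⟨y, hyi⟩, rfl, rfl⟩

theorem RootedAt.exists_isChild_between {A : Set V} (hA : RootedAt T r v A) (hc : T.Preconnected)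
    (ha : T.IsAcyclic) {x : V} (hx : x ∈ A) (hne : v ≠ x) :
    ∃ c ∈ A, IsChild T r v c ∧ Between T r c x := by
  obtain ⟨c, hvc, hcx⟩ := ScatteredTrees.exists_isChild_between hc ha (hA.between x hx) hne
  exact ⟨c, hA.mem_of_between x hx c hvc.2 hcx, hvc, hcx⟩

/-- The tree is the supremum of the successors of the trees above the children of its root. The
index `none` stands for the root alone; it is needed when the root has no children. -/
theorem RootedAt.mem_rootedClass {A : Set V} (hA : RootedAt T r v A) (hc : T.Preconnected)
    (ha : T.IsAcyclic) (hsub : ∀ c ∈ A, IsChild T r v c → {x | Between T r c x} ⊆ A)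
    {α : Ordinal.{u}} (hα : ∀ c ∈ A, IsChild T r v c → treeAbove hc ha r c ∈ rootedClass α) :
    hA.tree hc ha ∈ rootedClass α := by
  let B : Option {c // c ∈ A ∧ IsChild T r v c} → Set V := fun i =>
    i.elim {v} fun c => insert v {x | Between T r c x}
  have hB : ∀ i, RootedAt T r v (B i)
    | none => rootedAt_singleton hc v
    | some c => c.2.2.rootedAt_insert hc
  refine IsSup.mem_rootedClass (hA.isSup hc ha hB ?_ ?_ ?_ ?_) ?_
  · rintro (_ | c) x hx
    · exact hx ▸ hA.mem
    · exact hx.elim (· ▸ hA.mem) (hsub c c.2.1 c.2.2 ·)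
  · intro x hx
    by_cases hvx : v = x
    · exact ⟨none, hvx.symm⟩
    · obtain ⟨c, hcA, hvc, hcx⟩ := hA.exists_isChild_between hc ha hx hvx
      exact ⟨some ⟨c, hcA, hvc⟩, Or.inr hcx⟩
  · rintro (_ | c) (_ | d) hcd x hx hx'
    · exact hx
    · exact hx
    · exact hx'
    · refine hx.elim id fun hcx => hx'.elim id fun hdx => absurd ?_ hcd
      exact congrArg some (Subtype.ext (c.2.2.eq_of_between hc d.2.2 hcx hdx))
  · intro x hx y hy hxy
    have hvy : v ≠ y := by
      rintro rfl
      exact hxy.1.ne (hxy.2.antisymm hc (hA.between x hx))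
    obtain ⟨c, hcA, hvc, hcy⟩ := hA.exists_isChild_between hc ha hy hvy
    refine ⟨some ⟨c, hcA, hvc⟩, ?_, Or.inr hcy⟩
    by_cases hne : c = y
    · exact Or.inl (hxy.parent_unique hc (hne ▸ hvc))
    · exact Or.inr (hcy.of_adj hne hxy.1)
  · rintro (_ | c)
    · exact (isSuc_singleton hc ha v).mem_rootedClass (emptyTree_mem_rootedClass α)
    · exact (c.2.2.isSuc_insert hc ha).mem_rootedClass (hα c c.2.1 c.2.2)

theorem treeAbove_mem_rootedClass (hc : T.Preconnected) (ha : T.IsAcyclic) {α : Ordinal.{u}}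
    (h : ∀ c, IsChild T r v c → treeAbove hc ha r c ∈ rootedClass α) :
    treeAbove hc ha r v ∈ rootedClass α :=
  (rootedAt_above v).mem_rootedClass hc ha (fun _ hvc _ _ => hvc.trans) fun c _ => h c

/-- For a sequence `x` of vertices of the tree with root `r`, the vertices that lie above `x n` but
not above `x (n + 1)`. They span the `n`-th summand of the tree above `x 0`. -/
def layer (T : SimpleGraph V) (r : V) (x : ℕ → V) (n : ℕ) : Set V :=
  {y | Between T r (x n) y ∧ ¬ Between T r (x (n + 1)) y}

variable {x : ℕ → V}

theorem rootedAt_layer (hc : T.Preconnected) (hx : ∀ n, IsChild T r (x n) (x (n + 1))) (n : ℕ) :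
    RootedAt T r (x n) (layer T r x n) where
  mem := ⟨.refl _, fun h => (hx n).1.ne ((hx n).2.antisymm hc h)⟩
  between _ h := h.1
  mem_of_between _ ha _ hxy hya := ⟨hxy, fun h => ha.2 (h.trans hya)⟩

theorem exists_mem_layer (hc : T.Preconnected) (hx : ∀ n, IsChild T r (x n) (x (n + 1))) {y : V}
    (hy : Between T r (x 0) y) : ∃ n, y ∈ layer T r x n := by
  by_contra! hn
  have hle : ∀ n, Between T r (x n) y := fun n => by
    induction n with
    | zero => exact hy
    | succ n ih => exact not_not.1 fun h => hn n ⟨ih, h⟩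
  obtain ⟨p⟩ := hc r y
  exact Set.infinite_range_of_injective (injective_of_isChild hc hx)
    (p.support.finite_toSet.subset (Set.range_subset_iff.2 fun n => hle n p))

theorem eq_of_mem_layer (hx : ∀ n, IsChild T r (x n) (x (n + 1))) {y : V} {m n : ℕ}
    (hm : y ∈ layer T r x m) (hn : y ∈ layer T r x n) : m = n := by
  have hle : ∀ {k l}, y ∈ layer T r x k → y ∈ layer T r x l → l ≤ k := fun hk hl =>
    not_lt.1 fun h => hk.2 ((between_of_le_of_isChild hx h).trans hl.1)
  exact (hle hn hm).antisymm (hle hm hn)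

theorem eq_add_one_of_isChild_of_mem_layer (hc : T.Preconnected)
    (hx : ∀ n, IsChild T r (x n) (x (n + 1))) {y z : V} {m n : ℕ} (hmn : m ≠ n)
    (hy : y ∈ layer T r x m) (hz : z ∈ layer T r x n) (hyz : IsChild T r y z) :
    n = m + 1 ∧ x m = y ∧ x n = z := by
  obtain rfl : x n = z := by
    by_contra hne
    exact hmn (eq_of_mem_layer hx hy
      ⟨hz.1.of_adj hne hyz.1, fun h => hz.2 (h.trans hyz.2)⟩)
  rcases n with _ | n
  · exact absurd (hyz.2.antisymm hc ((between_of_le_of_isChild hx m.zero_le).trans hy.1))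
      hyz.1.ne
  · obtain rfl : y = x n := hyz.parent_unique hc (hx n)
    obtain rfl : m = n := eq_of_mem_layer hx hy (rootedAt_layer hc hx n).mem
    exact ⟨rfl, rfl, rfl⟩

theorem isPathSum_treeAbove (hc : T.Preconnected) (ha : T.IsAcyclic)
    (hx : ∀ n, IsChild T r (x n) (x (n + 1))) :
    IsPathSum (treeAbove hc ha r (x 0)) fun n => (rootedAt_layer hc hx n).tree hc ha := by
  refine ⟨fun n h => (h.false ⟨x n, (rootedAt_layer hc hx n).mem⟩).elim,
    fun n => T.induceHomOfLE fun y hy => (between_of_le_of_isChild hx n.zero_le).trans hy.1,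
    rfl, ?_, ?_, ?_⟩
  · rintro ⟨y, hy⟩
    obtain ⟨n, hn⟩ := exists_mem_layer hc hx hy
    exact ⟨n, ⟨y, hn⟩, rfl⟩
  · rintro m n ⟨y, hy⟩ ⟨z, hz⟩ hmn hyz
    obtain rfl : y = z := congrArg Subtype.val hyz
    exact hmn (eq_of_mem_layer hx hy hz)
  · rintro m n ⟨y, hy⟩ ⟨z, hz⟩ hmn
    constructor
    · intro (hyz : T.Adj y z)
      rcases isChild_or_isChild_of_adj (r := r) hc ha hyz with h | h
      · obtain ⟨hn, rfl, rfl⟩ := eq_add_one_of_isChild_of_mem_layer hc hx hmn hy hz h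
        exact ⟨Or.inl hn, rfl, rfl⟩
      · obtain ⟨hm, rfl, rfl⟩ := eq_add_one_of_isChild_of_mem_layer hc hx hmn.symm hz hy h
        exact ⟨Or.inr hm, rfl, rfl⟩
    · rintro ⟨h, hxy, hxz⟩
      obtain rfl : x m = y := congrArg Subtype.val (Option.some_injective _ hxy)
      obtain rfl : x n = z := congrArg Subtype.val (Option.some_injective _ hxz)
      rcases h with rfl | rfl
      exacts [(hx m).1, (hx n).1.symm]

theorem treeAbove_mem_rootedClass_add_one (hc : T.Preconnected) (ha : T.IsAcyclic)
    (hx : ∀ n, IsChild T r (x n) (x (n + 1))) {α : Ordinal.{u}}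
    (hα : ∀ n c, IsChild T r (x n) c → c ≠ x (n + 1) → treeAbove hc ha r c ∈ rootedClass α) :
    treeAbove hc ha r (x 0) ∈ rootedClass (α + 1) := by
  refine (isPathSum_treeAbove hc ha hx).mem_rootedClass fun n => ?_
  refine (rootedAt_layer hc hx n).mem_rootedClass hc ha (fun c hcn hxc y hcy => ?_)
    fun c hcn hxc => hα n c hxc ?_
  · exact ⟨hxc.2.trans hcy, fun h => hcn.2 (hxc.eq_of_between hc (hx n) hcy h ▸ .refl c)⟩
  · rintro rfl
    exact hcn.2 (.refl _)

theorem exists_treeAbove_mem_rootedClass_of_exists (hc : T.Preconnected) (ha : T.IsAcyclic)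
    (r : V) :
    ∃ α : Ordinal.{u}, ∀ v, (∃ β : Ordinal.{u}, treeAbove hc ha r v ∈ rootedClass β) →
      treeAbove hc ha r v ∈ rootedClass α := by
  choose! f hf using fun (v : V) (h : ∃ β : Ordinal.{u}, treeAbove hc ha r v ∈ rootedClass β) => h
  exact ⟨⨆ v, f v, fun v hv => rootedClass_mono (Ordinal.le_iSup f v) (hf v hv)⟩

theorem exists_forall_treeAbove_mem_rootedClass (hc : T.Preconnected) (ha : T.IsAcyclic)
    (h : ¬ Branching T r) : ∃ α : Ordinal.{u}, ∀ v, treeAbove hc ha r v ∈ rootedClass α := by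
  obtain ⟨α, hα⟩ := exists_treeAbove_mem_rootedClass_of_exists hc ha r
  refine ⟨α, fun v => not_not.1 fun hv => ?_⟩
  obtain ⟨b, hb, hchain⟩ := exists_isChain_of_not_branching h
    (B := {v | treeAbove hc ha r v ∉ rootedClass α}) ⟨v, hv⟩
  have hchild : ∀ v ∈ {v | treeAbove hc ha r v ∉ rootedClass α ∧ Between T r b v},
      ∃ c ∈ {v | treeAbove hc ha r v ∉ rootedClass α ∧ Between T r b v}, IsChild T r v c := by
    rintro v ⟨hv, hbv⟩
    by_contra! hn
    exact hv (treeAbove_mem_rootedClass hc ha fun c hvc =>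
      not_not.1 fun hcα => hn c ⟨hcα, hbv.trans hvc.2⟩ hvc)
  obtain ⟨x, rfl, hxα, hx⟩ := exists_seq_isChild hchild ⟨hb, .refl b⟩
  refine hb (hα _ ⟨α + 1, treeAbove_mem_rootedClass_add_one hc ha hx fun n c hxc hne => ?_⟩)
  by_contra hcα
  rcases hchain.total (hxα (n + 1)) ⟨hcα, (hxα n).2.trans hxc.2⟩ with hle | hle
  · exact hne (hxc.eq_of_between hc (hx n) (.refl c) hle)
  · exact hne (hxc.eq_of_between hc (hx n) hle (.refl _))

theorem inClassD_of_not_branching (hc : T.Preconnected) (ha : T.IsAcyclic)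
    (h : ¬ Branching T r) : InClassD T := by
  obtain ⟨α, hα⟩ := exists_forall_treeAbove_mem_rootedClass hc ha h
  exact ⟨α, _, hα r, ⟨⟨Equiv.subtypeUnivEquiv root_between, Iff.rfl⟩⟩⟩

theorem isScattered_of_isEmpty [IsEmpty V] : IsScattered T :=
  fun _ _ ⟨S⟩ => ⟨fun f => isEmptyElim (f (S.branch []))⟩

theorem topologicallyScattered_of_isEmpty [IsEmpty V] : TopologicallyScattered (Ends T) := by
  rintro S ⟨e, -⟩
  obtain ⟨C, -⟩ := Quotient.exists_rep e
  exact isEmptyElim (C.vertex 0)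

theorem inClassD_of_isEmpty [IsEmpty V] : InClassD T :=
  ⟨0, emptyTree, emptyTree_mem_rootedClass 0,
    ⟨⟨Equiv.equivOfIsEmpty PEmpty V, fun {x} => x.elim⟩⟩⟩

theorem IsScattered.of_iso {W : Type u} {F : SimpleGraph W} (h : IsScattered F) (f : F ≃g T) :
    IsScattered T :=
  fun W H hS => ⟨fun e => (h W H hS).false (e.trans f.symm.toEmbedding)⟩

theorem InClassD.isScattered (h : InClassD T) : IsScattered T := by
  obtain ⟨α, R, hR, ⟨f⟩⟩ := h
  refine IsScattered.of_iso ?_ f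
  cases hr : R.root with
  | none =>
    have := R.isEmpty_of_root_eq_none hr
    exact isScattered_of_isEmpty
  | some r =>
    exact (isScattered_iff_not_branching r R.preconnected R.isAcyclic).2
      (unbranched_of_mem_rootedClass α R hR r hr)

end Decomposition

end ScatteredTrees

theorem theorem6 {V : Type u} (T : SimpleGraph V) (hconn : T.Preconnected) (hacyc : T.IsAcyclic) :
    List.TFAE
      [ScatteredTrees.IsScattered T,
       ScatteredTrees.TopologicallyScattered (ScatteredTrees.Ends T),
       ScatteredTrees.InClassD T] := by
  open ScatteredTrees in
  rcases isEmpty_or_nonempty V with _ | ⟨⟨r⟩⟩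
  · tfae_have 1 → 2 := fun _ => topologicallyScattered_of_isEmpty
    tfae_have 2 → 3 := fun _ => inClassD_of_isEmpty
    tfae_have 3 → 1 := fun _ => isScattered_of_isEmpty
    tfae_finish
  · tfae_have 1 ↔ 2 := (isScattered_iff_not_branching r hconn hacyc).trans
      (topologicallyScattered_iff_not_branching hconn hacyc r).symm
    tfae_have 1 → 3 := fun h => inClassD_of_not_branching hconn hacyc
      ((isScattered_iff_not_branching r hconn hacyc).1 h)
    tfae_have 3 → 1 := InClassD.isScattered
    tfae_finish
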